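/- Let $\Sigma$ be a finite alphabet with at least two letters, and let $\Sigma^\omega$, the set of infinite words over $\Sigma$, carry the Cantor topology (the product of the discrete topologies). A probabilistic Büchi automaton (PBA) $\mathcal B=(Q,q_s,Q_f,\delta)$ over $\Sigma$ consists of a finite set $Q$ of states, an initial state $q_s\in Q$, a set $Q_f\subseteq Q$ of final states and a function $\delta:Q\times\Sigma\times Q\to[0,1]$ with $\sum_{q'}\delta(q,a,q')=1$ for all $q\in Q$, $a\in\Sigma$. A word $\alpha=a_0a_1\cdots\in\Sigma^\omega$ determines the Markov measure on $Q^\omega$ that starts in $q_s$ and at time $n$ moves from $q$ to $q'$ with probability $\delta(q,a_n,q')$; let $\mu^{acc}_{\mathcal B,\alpha}$ be the probability that a run is in $Q_f$ at infinitely many times. Put $\mathcal L_{\ge x}(\mathcal B)=\{\alpha:\mu^{acc}_{\mathcal B,\alpha}\ge x\}$ and $\mathcal L_{=1}(\mathcal B)=\{\alpha:\mu^{acc}_{\mathcal B,\alpha}=1\}$. A (nondeterministic) Büchi automaton, with one initial state, accepts a word if some run on it is in the accepting set at infinitely many times; it is deterministic if every state has exactly one successor for every letter. Consider the following classes of subsets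 of $\Sigma^\omega$: - $\mathrm{AlmostSure}$: the languages $\mathcal L_{=1}(\mathcal B)$ of PBAs $\mathcal B$ over $\Sigma$; - $\mathrm{Regular}$: the languages accepted by Büchi automata with finitely many states; - $\mathrm{Deterministic}$: the languages accepted by deterministic Büchi automata with a possibly infinite set of states; - $\mathcal G_\delta$: the countable intersections of open subsets of $\Sigma^\omega$. Then: 1. for every PBA $\mathcal B$ over $\Sigma$ and every $x\in[0,1]$, $\mathcal L_{\ge x}(\mathcal B)$ is a $\mathcal G_\delta$ set; in particular $\mathcal L_{=1}(\mathcal B)$ is a $\mathcal G_\delta$ set; 2. $\mathrm{Regular}\cap\mathrm{AlmostSure}=\mathrm{Regular}\cap\mathrm{Deterministic}$, and this class consists exactly of the languages accepted by deterministic Büchi automata with finitely many states; 3. $\mathrm{Regular}\cap\mathrm{Deterministic}\subsetneq\mathrm{AlmostSure}\subsetneq\mathcal G_\delta=\mathrm{Deterministic}$. -/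

import Mathlib

namespace ProbBuchi

open MeasureTheory ProbabilityTheory Filter

/-! ### Büchi automata on infinite words

An infinite word over the alphabet `α` is a function `ℕ → α`; a language is a set of such words and
a class of languages is a set of languages. -/

/-- A Büchi automaton over the alphabet `α` with state space `Q` (not necessarily finite). -/
structure BuchiAutomaton (α : Type*) (Q : Type*) where
  start : Q
  accept : Set Q
  step : Q → α → Q → Prop

namespace BuchiAutomaton

variable {α Q : Type*} (A : BuchiAutomaton α Q)

def IsDeterministic : Prop := ∀ q a, ∃! q', A.step q a q'

/-- `r` is a run of the automaton on the infinite word `w`. -/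
def IsRun (w : ℕ → α) (r : ℕ → Q) : Prop :=
  r 0 = A.start ∧ ∀ i, A.step (r i) (w i) (r (i + 1))

/-- The words having a run that is in the accepting set at infinitely many times. -/
def language : Set (ℕ → α) :=
  {w | ∃ r : ℕ → Q, A.IsRun w r ∧ ∃ᶠ i in atTop, r i ∈ A.accept}

end BuchiAutomaton

/-- The `ω`-regular languages: those accepted by Büchi automata with finitely many states. -/
def Regular (α : Type*) : Set (Set (ℕ → α)) :=
  {L | ∃ (Q : Type) (_ : Finite Q) (A : BuchiAutomaton α Q), A.language = L}

/-- The languages accepted by deterministic Büchi automata whose state space may be infinite. (Over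
a finite alphabet only countably many states are reachable, so `Q : Type` is no restriction.) -/
def Deterministic (α : Type*) : Set (Set (ℕ → α)) :=
  {L | ∃ (Q : Type) (A : BuchiAutomaton α Q), A.IsDeterministic ∧ A.language = L}

/-- The languages accepted by deterministic Büchi automata with finitely many states. -/
def FiniteDeterministic (α : Type*) : Set (Set (ℕ → α)) :=
  {L | ∃ (Q : Type) (_ : Finite Q) (A : BuchiAutomaton α Q), A.IsDeterministic ∧ A.language = L}

/-! ### The Cantor topology -/

/-- The topology on infinite words: the product of discrete topologies. -/
@[reducible] def cantorTopology (α : Type*) : TopologicalSpace (ℕ → α) :=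
  @Pi.topologicalSpace ℕ (fun _ => α) (fun _ => ⊥)

/-- The languages that are countable intersections of open sets. -/
def GDelta (α : Type*) : Set (Set (ℕ → α)) :=
  {L | @IsGδ _ (cantorTopology α) L}

/-! ### Probabilistic Büchi automata -/

/-- A probabilistic Büchi automaton; `trans q a q'` is the probability of moving from `q` to `q'`
when `a` is read. The state space is required to be finite wherever the structure is used. -/
structure PBA (α : Type*) (Q : Type*) where
  start : Q
  final : Set Q
  trans : Q → α → PMF Q

namespace PBA

variable {α Q : Type*}

section RunMeasure

variable [Finite Q] [MeasurableSpace Q] [DiscreteMeasurableSpace Q] (B : PBA α Q) (w : ℕ → α)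

/-- The law of the state at time `n + 1` given the states up to time `n`, on the input word `w`. -/
noncomputable def stepKernel (n : ℕ) : Kernel ((_ : Finset.Iic n) → Q) Q :=
  Kernel.ofFunOfCountable fun h => (B.trans (h ⟨n, Finset.mem_Iic.2 le_rfl⟩) (w n)).toMeasure

instance (n : ℕ) : IsMarkovKernel (B.stepKernel w n) :=
  ⟨fun h => PMF.toMeasure.isProbabilityMeasure (B.trans (h ⟨n, Finset.mem_Iic.2 le_rfl⟩) (w n))⟩

/-- The probability measure on runs generated by `B` and the input word `w`: the law of the Markov
chain that starts in `B.start` and moves at time `n` according to `B.trans · (w n)`. -/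
noncomputable def runMeasure : Measure (ℕ → Q) :=
  Kernel.traj (X := fun _ => Q) (B.stepKernel w) 0 (fun _ => B.start)

instance : IsProbabilityMeasure (B.runMeasure w) := by
  unfold runMeasure; infer_instance

/-- The values of the run measure on cylinders, which determine it. -/
theorem runMeasure_cylinder (u : ℕ → Q) (n : ℕ) :
    B.runMeasure w {r | ∀ i ≤ n, r i = u i} =
      Set.indicator {B.start} 1 (u 0) * ∏ i ∈ Finset.range n, B.trans (u i) (w i) (u (i + 1)) := by
  induction n with
  | zero =>
    have h := congrFun (congrArg DFunLike.coe
      (Kernel.traj_map_frestrictLe_apply (X := fun _ => Q) (κ := B.stepKernel w) 0 0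
        (fun _ => B.start)))
      {h | h ⟨0, Finset.mem_Iic.2 le_rfl⟩ = u 0}
    rw [Measure.map_apply (by fun_prop) (Set.toFinite _).measurableSet,
      Kernel.partialTraj_self, Kernel.id_apply,
      Measure.dirac_apply' _ (Set.toFinite _).measurableSet] at h
    have hs : {r : ℕ → Q | ∀ i ≤ 0, r i = u i} =
        (Preorder.frestrictLe (π := fun _ => Q) 0) ⁻¹'
          {h | h ⟨0, Finset.mem_Iic.2 le_rfl⟩ = u 0} := by
      ext r; simp
    rw [hs, runMeasure, h]
    by_cases hu : u 0 = B.start <;> simp [hu, eq_comm]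
  | succ n ih =>
    have h := congrFun (congrArg DFunLike.coe
      (Kernel.partialTraj_compProd_eq_map_traj (X := fun _ => Q) (κ := B.stepKernel w)
        (Nat.zero_le n) (x₀ := fun _ => B.start)))
      ({Preorder.frestrictLe (π := fun _ => Q) n u} ×ˢ {u (n + 1)})
    have hm : MeasurableSet ({Preorder.frestrictLe (π := fun _ => Q) n u} ×ˢ {u (n + 1)}) :=
      (measurableSet_singleton _).prod (measurableSet_singleton _)
    rw [Measure.map_apply (by fun_prop) hm,
      Measure.compProd_apply_prod (measurableSet_singleton _) (measurableSet_singleton _),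
      lintegral_singleton] at h
    have h0 := congrFun (congrArg DFunLike.coe
      (Kernel.traj_map_frestrictLe_apply (X := fun _ => Q) (κ := B.stepKernel w) 0 n
        (fun _ => B.start))) {Preorder.frestrictLe (π := fun _ => Q) n u}
    rw [Measure.map_apply (by fun_prop) (measurableSet_singleton _)] at h0
    have hk : B.stepKernel w n (Preorder.frestrictLe (π := fun _ => Q) n u) {u (n + 1)} =
        B.trans (u n) (w n) (u (n + 1)) :=
      PMF.toMeasure_apply_singleton _ _ (measurableSet_singleton _)
    have hs0 : {r : ℕ → Q | ∀ i ≤ n, r i = u i} =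
        (Preorder.frestrictLe (π := fun _ => Q) n) ⁻¹'
          {Preorder.frestrictLe (π := fun _ => Q) n u} := by
      ext r; simp [funext_iff]
    have hs : {r : ℕ → Q | ∀ i ≤ n + 1, r i = u i} =
        (fun x => (Preorder.frestrictLe (π := fun _ => Q) n x, x (n + 1))) ⁻¹'
          ({Preorder.frestrictLe (π := fun _ => Q) n u} ×ˢ {u (n + 1)}) := by
      ext r
      simp only [Set.mem_ofPred_eq, Set.mem_preimage, Set.mem_prod, Set.mem_singleton_iff,
        funext_iff, Subtype.forall, Finset.mem_Iic, Preorder.frestrictLe_apply]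
      constructor
      · exact fun h => ⟨fun i hi => h i (by omega), h _ le_rfl⟩
      · rintro ⟨h1, h2⟩ i hi
        rcases Nat.lt_or_ge n i with hn | hn
        · obtain rfl : i = n + 1 := by omega
          exact h2
        · exact h1 i hn
    rw [Finset.prod_range_succ, ← mul_assoc, ← ih, hs, hs0, runMeasure, ← h, h0, hk, mul_comm]

end RunMeasure

/-- The probability that a run of `B` on `w` is in a final state infinitely often. -/
noncomputable def acceptProb [Finite Q] (B : PBA α Q) (w : ℕ → α) : ℝ :=
  letI : MeasurableSpace Q := ⊤
  (B.runMeasure w).real {r | ∃ᶠ i in atTop, r i ∈ B.final}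

/-- The words accepted with probability at least `x`. -/
def cutpointLanguage [Finite Q] (B : PBA α Q) (x : ℝ) : Set (ℕ → α) :=
  {w | x ≤ B.acceptProb w}

/-- The words accepted with probability one. -/
def almostSureLanguage [Finite Q] (B : PBA α Q) : Set (ℕ → α) :=
  {w | B.acceptProb w = 1}

end PBA

/-- The languages of finite-state probabilistic Büchi automata under the almost-sure semantics. -/
def AlmostSure (α : Type*) : Set (Set (ℕ → α)) :=
  {L | ∃ (Q : Type) (_ : Finite Q) (B : PBA α Q), B.almostSureLanguage = L}

end ProbBuchi

namespace ProbBuchi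

open MeasureTheory ProbabilityTheory Filter

open scoped ENNReal

/-! ### Topology of infinite words -/

section Topology

variable {α : Type*}

/-! Cutpoint languages are Gδ because the probability of visiting a final state between the times
`m` and `k` depends on the first `k` letters only, so exceeding a rational is an open condition. By
`measure_frequently_eq_iInf_iSup` the acceptance probability is an infimum over `m` of suprema over
`k` of such probabilities. Conversely, a deterministic automaton that stores the whole prefix
accepts any given Gδ set over a finite alphabet.

The regular part is Landweber's theorem: a regular Gδ language has a finite deterministic Büchi
automaton. A regular language is recognized by a finite monoid (`recognizes_backward`), and by
Ramsey every word factors with values `s, e, e, …`, where `e` is idempotent. The automaton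
`detectStep` looks for infinitely many returns to `s` through factors ending in `e`. Every word of
the language produces them; conversely, the Gδ property makes them sufficient
(`Recognizes.mem_of_frequently_return`), since repeating the factors of value `e` often enough
forces the word into each open set in turn without changing any value. Finite deterministic automata
are probabilistic automata with Dirac transitions, so the regular almost-sure languages are exactly
the regular deterministic ones.

Both inclusions in the hierarchy are strict. Almost-sure acceptance of the rest of a word depends on
the past only through the set of states reached with positive probability; hence a one-word
almost-sure language consists of an eventually periodic word, while every singleton is Gδ. The coin
automaton accepts a word of equal blocks almost surely, but a word of growing blocks with
probability zero by Borel–Cantelli; a finite monoid cannot separate two such words whose blocks all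
have the same value. -/

theorem isOpen_cantor_iff {U : Set (ℕ → α)} :
    @IsOpen _ (cantorTopology α) U ↔
      ∀ w ∈ U, ∃ k, ∀ w', (∀ i < k, w' i = w i) → w' ∈ U := by
  let _ : TopologicalSpace α := ⊥
  have : DiscreteTopology α := ⟨rfl⟩
  have hb := PiNat.isTopologicalBasis_cylinders (fun _ : ℕ => α)
  constructor
  · intro hU w hw
    obtain ⟨_, ⟨x, n, rfl⟩, hx, hsub⟩ := hb.exists_subset_of_mem_open hw hU
    refine ⟨n, fun w' h => hsub ?_⟩
    rw [PiNat.mem_cylinder_iff] at hx ⊢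
    exact fun i hi => (h i hi).trans (hx i hi)
  · intro h
    refine hb.isOpen_iff.2 fun w hw => ?_
    obtain ⟨k, hk⟩ := h w hw
    exact ⟨_, ⟨w, k, rfl⟩, PiNat.self_mem_cylinder w k,
      fun w' hw' => hk w' (PiNat.mem_cylinder_iff.1 hw')⟩

theorem mem_GDelta_iff {L : Set (ℕ → α)} :
    L ∈ GDelta α ↔ ∃ O : ℕ → Set (ℕ → α),
      (∀ n, ∀ w ∈ O n, ∃ k, ∀ w', (∀ i < k, w' i = w i) → w' ∈ O n) ∧
        ∀ w, w ∈ L ↔ ∀ n, w ∈ O n := by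
  let _ := cantorTopology α
  change IsGδ L ↔ _
  rw [isGδ_iff_eq_iInter_nat]
  refine exists_congr fun O => and_congr (forall_congr' fun n => isOpen_cantor_iff) ?_
  simp [Set.ext_iff]

/-- A language given by countably many conditions, each of which is witnessed by a finite prefix,
is a `Gδ` set. -/
theorem mem_GDelta_of_countable {ι : Type*} [Countable ι] {L : Set (ℕ → α)}
    (O : ι → Set (ℕ → α)) (hO : ∀ n, ∀ w ∈ O n, ∃ k, ∀ w', (∀ i < k, w' i = w i) → w' ∈ O n)
    (hL : ∀ w, w ∈ L ↔ ∀ n, w ∈ O n) : L ∈ GDelta α := by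
  let _ := cantorTopology α
  have : L = ⋂ n, O n := by ext w; simp [hL]
  rw [this]
  exact IsGδ.iInter fun n => (isOpen_cantor_iff.2 (hO n)).isGδ

theorem singleton_mem_GDelta (w : ℕ → α) : {w} ∈ GDelta α := by
  refine mem_GDelta_iff.2 ⟨fun n => {v | v n = w n}, fun n v hv => ⟨n + 1, fun v' h => ?_⟩, ?_⟩
  · exact (h n n.lt_succ_self).trans hv
  · exact fun v => ⟨fun h n => congrFun h n, fun h => funext h⟩

end Topology

/-! ### Finite factors of infinite words -/

section Factors

variable {α M : Type*}

/-- The factor of the infinite word `w` between the positions `i` and `j`. -/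
def factor (w : ℕ → α) (i j : ℕ) : List α := (List.Ico i j).map w

theorem factor_length (w : ℕ → α) (i j : ℕ) : (factor w i j).length = j - i := by
  simp [factor]

theorem factor_append (w : ℕ → α) {i j k : ℕ} (hij : i ≤ j) (hjk : j ≤ k) :
    factor w i j ++ factor w j k = factor w i k := by
  rw [factor, factor, factor, ← List.map_append, List.Ico.append_consecutive hij hjk]

theorem factor_self (w : ℕ → α) (i : ℕ) : factor w i i = [] := by simp [factor]

theorem factor_succ (w : ℕ → α) {i j : ℕ} (h : i ≤ j) :
    factor w i (j + 1) = factor w i j ++ [w j] := by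
  simp [factor, List.Ico.succ_top h]

theorem factor_congr {w w' : ℕ → α} {i j : ℕ} (h : ∀ k, i ≤ k → k < j → w k = w' k) :
    factor w i j = factor w' i j := by
  refine List.map_congr_left fun k hk => ?_
  rw [List.Ico.mem] at hk
  exact h k hk.1 hk.2

theorem factor_zero_eq_iff {w w' : ℕ → α} {n : ℕ} :
    factor w 0 n = factor w' 0 n ↔ ∀ i < n, w i = w' i := by
  refine ⟨fun h i hi => ?_, fun h => factor_congr fun k _ hk => h k hk⟩
  rw [factor, factor, List.map_inj_left] at h
  exact h i (List.Ico.mem.2 ⟨i.zero_le, hi⟩)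

theorem getElem_factor_zero (w : ℕ → α) {n i : ℕ} (h : i < (factor w 0 n).length) :
    (factor w 0 n)[i] = w i := by
  simp [factor, List.Ico]

/-- Every sequence of finite words, each extending the one before by a nonempty word, has a
limit. -/
theorem exists_limit_word (p v : ℕ → List α) (hp : ∀ i, p (i + 1) = p i ++ v i)
    (hv : ∀ i, v i ≠ []) : ∃ w : ℕ → α, ∀ i, factor w 0 (p i).length = p i := by
  have hlen : ∀ i, i ≤ (p i).length := by
    intro i
    induction i with
    | zero => exact Nat.zero_le _
    | succ i ih =>
      have := List.length_pos_iff.2 (hv i)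
      rw [hp, List.length_append]; omega
  have hpre : ∀ i j, i ≤ j → p i <+: p j := by
    intro i j h
    induction j, h using Nat.le_induction with
    | base => exact List.prefix_rfl
    | succ j _ ih => exact ih.trans ⟨v j, (hp j).symm⟩
  refine ⟨fun n => (p (n + 1))[n]'(hlen (n + 1)), fun i => ?_⟩
  refine List.ext_getElem (by simp [factor_length]) fun n h1 h2 => ?_
  rw [getElem_factor_zero]
  rcases le_total (n + 1) i with h | h
  · exact (hpre _ _ h).getElem _
  · exact ((hpre _ _ h).getElem _).symm

theorem factor_of_limit {p v : ℕ → List α} (hp : ∀ i, p (i + 1) = p i ++ v i)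
    {w : ℕ → α} (hw : ∀ i, factor w 0 (p i).length = p i) (i : ℕ) :
    factor w (p i).length (p (i + 1)).length = v i := by
  have h := factor_append w (Nat.zero_le (p i).length)
    (show (p i).length ≤ (p (i + 1)).length by rw [hp]; simp)
  rw [hw, hw, hp i] at h
  rw [hp i]
  exact List.append_cancel_left h

/-- The value of a finite word in a monoid. -/
def value [Monoid M] (φ : α → M) (u : List α) : M := (u.map φ).prod

variable [Monoid M] (φ : α → M)

theorem value_append (u v : List α) : value φ (u ++ v) = value φ u * value φ v := by
  simp [value]

@[simp] theorem value_nil : value φ [] = 1 := rfl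

@[simp] theorem value_singleton (a : α) : value φ [a] = φ a := by simp [value]

theorem value_factor_mul (w : ℕ → α) {i j k : ℕ} (hij : i ≤ j) (hjk : j ≤ k) :
    value φ (factor w i j) * value φ (factor w j k) = value φ (factor w i k) := by
  rw [← value_append, factor_append w hij hjk]

end Factors

/-! ### Deterministic automata -/

section DeterministicAutomata

variable {α Q : Type*}

/-- The state of a deterministic automaton after `n` letters of `w`. -/
def stateAfter (δ : Q → α → Q) (q : Q) (w : ℕ → α) : ℕ → Q
  | 0 => q
  | n + 1 => δ (stateAfter δ q w n) (w n)

/-- The Büchi language of the deterministic automaton with transition function `δ`. -/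
def stepLanguage (δ : Q → α → Q) (q : Q) (F : Set Q) : Set (ℕ → α) :=
  {w | ∃ᶠ i in atTop, stateAfter δ q w i ∈ F}

/-- The Büchi automaton with transition function `δ`. -/
def BuchiAutomaton.ofStep (δ : Q → α → Q) (q : Q) (F : Set Q) : BuchiAutomaton α Q where
  start := q
  accept := F
  step p a p' := p' = δ p a

theorem BuchiAutomaton.ofStep_isDeterministic (δ : Q → α → Q) (q : Q) (F : Set Q) :
    (BuchiAutomaton.ofStep δ q F).IsDeterministic := fun p a => ⟨δ p a, rfl, fun _ h => h⟩

theorem BuchiAutomaton.ofStep_language (δ : Q → α → Q) (q : Q) (F : Set Q) :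
    (BuchiAutomaton.ofStep δ q F).language = stepLanguage δ q F := by
  ext w
  constructor
  · rintro ⟨r, ⟨h0, hs⟩, hr⟩
    have : r = stateAfter δ q w := by
      funext n
      induction n with
      | zero => exact h0
      | succ n ih => rw [stateAfter, ← ih]; exact hs n
    subst this
    exact hr
  · exact fun h => ⟨stateAfter δ q w, ⟨rfl, fun _ => rfl⟩, h⟩

theorem BuchiAutomaton.IsDeterministic.exists_eq_ofStep {A : BuchiAutomaton α Q}
    (hA : A.IsDeterministic) : ∃ δ, A = BuchiAutomaton.ofStep δ A.start A.accept := by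
  choose δ h1 h2 using hA
  refine ⟨δ, ?_⟩
  obtain ⟨q, F, s⟩ := A
  simp only [BuchiAutomaton.ofStep, BuchiAutomaton.mk.injEq, true_and]
  ext p a p'
  exact ⟨h2 p a p', fun h => h ▸ h1 p a⟩

theorem mem_Deterministic_iff {L : Set (ℕ → α)} :
    L ∈ Deterministic α ↔
      ∃ (Q : Type) (δ : Q → α → Q) (q : Q) (F : Set Q), stepLanguage δ q F = L := by
  constructor
  · rintro ⟨Q, A, hA, rfl⟩
    obtain ⟨δ, h⟩ := hA.exists_eq_ofStep
    exact ⟨Q, δ, A.start, A.accept, by rw [← BuchiAutomaton.ofStep_language, ← h]⟩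
  · rintro ⟨Q, δ, q, F, rfl⟩
    exact ⟨Q, _, BuchiAutomaton.ofStep_isDeterministic δ q F, BuchiAutomaton.ofStep_language δ q F⟩

theorem mem_FiniteDeterministic_iff {L : Set (ℕ → α)} :
    L ∈ FiniteDeterministic α ↔
      ∃ (Q : Type) (_ : Finite Q) (δ : Q → α → Q) (q : Q) (F : Set Q), stepLanguage δ q F = L := by
  constructor
  · rintro ⟨Q, hQ, A, hA, rfl⟩
    obtain ⟨δ, h⟩ := hA.exists_eq_ofStep
    exact ⟨Q, hQ, δ, A.start, A.accept, by rw [← BuchiAutomaton.ofStep_language, ← h]⟩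
  · rintro ⟨Q, hQ, δ, q, F, rfl⟩
    exact ⟨Q, hQ, _, BuchiAutomaton.ofStep_isDeterministic δ q F,
      BuchiAutomaton.ofStep_language δ q F⟩

theorem stateAfter_congr (δ : Q → α → Q) (q : Q) {w w' : ℕ → α} {n : ℕ}
    (h : ∀ i < n, w' i = w i) : stateAfter δ q w' n = stateAfter δ q w n := by
  induction n with
  | zero => rfl
  | succ n ih => rw [stateAfter, stateAfter, ih fun i hi => h i (by omega), h n n.lt_succ_self]

theorem FiniteDeterministic_subset : FiniteDeterministic α ⊆ Regular α ∩ Deterministic α :=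
  fun _ ⟨Q, hQ, A, hA, hL⟩ => ⟨⟨Q, hQ, A, hL⟩, ⟨Q, A, hA, hL⟩⟩

theorem Deterministic_subset_GDelta : Deterministic α ⊆ GDelta α := by
  intro L hL
  obtain ⟨Q, δ, q, F, rfl⟩ := mem_Deterministic_iff.1 hL
  refine mem_GDelta_iff.2 ⟨fun n => {w | ∃ i ≥ n, stateAfter δ q w i ∈ F}, ?_, fun w => ?_⟩
  · rintro n w ⟨i, hi, hF⟩
    exact ⟨i, fun w' h => ⟨i, hi, by rwa [stateAfter_congr δ q h]⟩⟩
  · exact frequently_atTop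

/-- The state is the prefix read. It is accepting when, for some `n`, it is the shortest prefix that
forces membership in the first open sets up to index `n`. -/
theorem GDelta_subset_Deterministic [Finite α] : GDelta α ⊆ Deterministic α := by
  intro L hL
  obtain ⟨O, hO, hOL⟩ := mem_GDelta_iff.1 hL
  obtain ⟨k, ⟨e⟩⟩ := Finite.exists_equiv_fin α
  -- the prefix of length `m` has length at least `n` and forces membership in `O 0, …, O n`
  let full : ℕ → ℕ → (ℕ → α) → Prop := fun n m w =>
    n ≤ m ∧ ∀ w', (∀ i < m, w' i = w i) → ∀ i ≤ n, w' ∈ O i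
  let acc : ℕ → (ℕ → α) → Prop := fun m w => ∃ n, full n m w ∧ ∀ m' < m, ¬ full n m' w
  have full_congr : ∀ {n m w w'}, (∀ i < m, w' i = w i) → full n m w → full n m w' := by
    intro n m w w' h hf
    exact ⟨hf.1, fun v hv => hf.2 v fun i hi => (hv i hi).trans (h i hi)⟩
  have acc_congr : ∀ {m w w'}, (∀ i < m, w' i = w i) → acc m w → acc m w' := by
    rintro m w w' h ⟨n, hf, hm⟩
    exact ⟨n, full_congr h hf, fun m' hm' hf' => hm m' hm'
      (full_congr (fun i hi => (h i (hi.trans hm')).symm) hf')⟩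
  have key : ∀ w, (∃ᶠ m in atTop, acc m w) ↔ w ∈ L := by
    intro w
    rw [hOL]
    constructor
    -- If `w` missed `O N`, only indices below `N` could be responsible for acceptance, and each of
    -- them has just one shortest prefix.
    · intro h N
      by_contra hN
      have hlt : ∃ᶠ m in atTop, ∃ n ∈ Finset.range N, full n m w ∧ ∀ m' < m, ¬ full n m' w := by
        refine h.mono fun m ⟨n, hf, hm⟩ => ⟨n, Finset.mem_range.2 ?_, hf, hm⟩
        by_contra hn
        exact hN (hf.2 w (fun _ _ => rfl) N (not_lt.1 hn))
      have : ∃ n ∈ Finset.range N, ∃ᶠ m in atTop, full n m w ∧ ∀ m' < m, ¬ full n m' w := by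
        by_contra hcon
        push Not at hcon
        refine hlt ?_
        have := (Filter.eventually_all_finset (Finset.range N) (l := atTop)
          (p := fun n m => ¬ (full n m w ∧ ∀ m' < m, ¬ full n m' w))).2
            fun n hn => (not_frequently.1 (by simpa using hcon n hn))
        filter_upwards [this] with m hm
        rintro ⟨n, hn, h⟩
        exact hm n hn h
      obtain ⟨n, -, hn⟩ := this
      obtain ⟨m, -, hm⟩ := frequently_atTop.1 hn 0
      obtain ⟨m', hm', h'⟩ := frequently_atTop.1 hn (m + 1)
      exact h'.2 m hm' hm.1
    · intro h
      rw [frequently_atTop]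
      intro N
      choose K hK using fun i => hO i w (h i)
      have hex : ∃ m, full N m w := by
        refine ⟨N + (Finset.range (N + 1)).sup K, Nat.le_add_right _ _, fun w' hw' i hi => ?_⟩
        refine hK i w' fun j hj => hw' j ?_
        have := Finset.le_sup (f := K) (show i ∈ Finset.range (N + 1) from Finset.mem_range.2 (by omega))
        omega
      classical
      -- The clause `n ≤ m` in `full` puts this accepting position at or beyond `N`.
      exact ⟨Nat.find hex, (Nat.find_spec hex).1, N, Nat.find_spec hex, fun m' => Nat.find_min hex⟩
  -- Coding letters in `Fin k` keeps the state space in `Type`, whatever the universe of `α`.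
  refine mem_Deterministic_iff.2 ⟨List (Fin k), fun u a => u ++ [e a], [],
    {u | ∃ w, u = (factor w 0 u.length).map e ∧ acc u.length w}, ?_⟩
  have hst : ∀ w n, stateAfter (fun (u : List (Fin k)) a => u ++ [e a]) [] w n =
      (factor w 0 n).map e := by
    intro w n
    induction n with
    | zero => simp [stateAfter, factor]
    | succ n ih => rw [stateAfter, ih, factor_succ w n.zero_le, List.map_append]; rfl
  ext w
  rw [← key w, stepLanguage]
  refine frequently_congr (Eventually.of_forall fun n => ?_)
  simp only [hst, Set.mem_ofPred_eq, List.length_map, factor_length, Nat.sub_zero]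
  constructor
  · rintro ⟨w', h, hacc⟩
    have h' := factor_zero_eq_iff.1 (List.map_injective_iff.2 e.injective h)
    exact acc_congr h' hacc
  · exact fun h => ⟨w, rfl, h⟩

theorem GDelta_eq_Deterministic [Finite α] : GDelta α = Deterministic α :=
  Set.Subset.antisymm GDelta_subset_Deterministic Deterministic_subset_GDelta

end DeterministicAutomata

/-! ### Recognition of languages of infinite words by finite monoids -/

section Recognition

variable {α M : Type*} [Monoid M]

/-- Membership of an infinite word in `L` only depends on the values of the factors of any
factorization of the word. -/
def Recognizes (φ : α → M) (L : Set (ℕ → α)) : Prop :=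
  ∀ w w' (t t' : ℕ → ℕ), StrictMono t → StrictMono t' → t 0 = 0 → t' 0 = 0 →
    (∀ i, value φ (factor w (t i) (t (i + 1))) = value φ (factor w' (t' i) (t' (i + 1)))) →
      w ∈ L → w' ∈ L

/-- All words with a factorization of value `s, e, e, e, …` are in `L`. -/
def AcceptingPair (φ : α → M) (L : Set (ℕ → α)) (s e : M) : Prop :=
  ∀ w (t : ℕ → ℕ), StrictMono t → t 0 = 0 → value φ (factor w 0 (t 1)) = s →
    (∀ i, value φ (factor w (t (i + 1)) (t (i + 2))) = e) → w ∈ L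

theorem Recognizes.acceptingPair {φ : α → M} {L : Set (ℕ → α)} (h : Recognizes φ L)
    {w : ℕ → α} (hw : w ∈ L) {t : ℕ → ℕ} (ht : StrictMono t) (ht0 : t 0 = 0) {e : M}
    (he : ∀ i, value φ (factor w (t (i + 1)) (t (i + 2))) = e) :
    AcceptingPair φ L (value φ (factor w 0 (t 1))) e := by
  intro w' t' ht' ht0' hs he'
  refine h w w' t t' ht ht' ht0 ht0' (fun i => ?_) hw
  cases i with
  | zero => rw [ht0, ht0', hs]
  | succ i => rw [he, he']

/-- The additive Ramsey theorem along an infinite word. -/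
theorem exists_idempotent_factorization [Finite M] (φ : α → M) (w : ℕ → α) :
    ∃ (e : M) (t : ℕ → ℕ), StrictMono t ∧ e * e = e ∧
      ∀ i, value φ (factor w (t i) (t (i + 1))) = e := by
  have color : ∀ g : ℕ → M, ∃ c, ∀ᶠ j in (hyperfilter ℕ : Filter ℕ), g j = c := by
    intro g
    obtain ⟨c, hc⟩ := Ultrafilter.eq_pure_of_finite ((hyperfilter ℕ).map g)
    refine ⟨c, ?_⟩
    have : {c} ∈ (hyperfilter ℕ).map g := by rw [hc]; exact Ultrafilter.mem_pure.2 rfl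
    exact Ultrafilter.mem_map.1 this
  have hgt : ∀ i, ∀ᶠ j in (hyperfilter ℕ : Filter ℕ), i < j := fun i =>
    Nat.hyperfilter_le_atTop (eventually_gt_atTop i)
  -- `c i` is the limit colour of the factors starting at `i` along a nonprincipal ultrafilter; `e`
  -- will be the limit of `c`.
  choose c hc using fun i => color fun j => value φ (factor w i j)
  obtain ⟨e, he⟩ := color c
  have step : ∀ i, c i = e → ∃ j, i < j ∧ c j = e ∧ value φ (factor w i j) = e := by
    intro i hi
    obtain ⟨j, h1, h2, h3⟩ := ((hgt i).and (he.and (hc i))).exists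
    exact ⟨j, h1, h2, h3.trans hi⟩
  choose! next h1 h2 h3 using step
  obtain ⟨i₀, hi₀⟩ := he.exists
  have hc' : ∀ n, c (next^[n] i₀) = e := by
    intro n
    induction n with
    | zero => exact hi₀
    | succ n ih => rw [Function.iterate_succ_apply']; exact h2 _ ih
  refine ⟨e, fun n => next^[n] i₀, strictMono_nat_of_lt_succ fun n => ?_, ?_, fun n => ?_⟩
  · rw [Function.iterate_succ_apply']; exact h1 _ (hc' n)
  -- A common end `k` at which the factors from `i₀` and from `next i₀` both have value `e` gives `e
  -- * e = e`.
  · have hj := h3 _ hi₀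
    obtain ⟨k, hk, h4, h5⟩ :=
      ((hgt (next i₀)).and ((hc i₀).and (hc (next i₀)))).exists
    rw [hi₀] at h4
    rw [h2 _ hi₀] at h5
    have := value_factor_mul φ w (h1 _ hi₀).le hk.le
    rwa [hj, h4, h5] at this
  · simp only [Function.iterate_succ_apply']; exact h3 _ (hc' n)

theorem value_replicate (φ : α → M) (x : List α) (n : ℕ) :
    value φ (List.replicate n x).flatten = value φ x ^ n := by
  induction n with
  | zero => simp
  | succ n ih => rw [List.replicate_succ, List.flatten_cons, value_append, ih, pow_succ']

/-- If `L` is a `Gδ` set, then infinitely many factors that return to `s` and end in `e` may be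
inserted without leaving `L`. -/
theorem Recognizes.mem_of_frequently_return {φ : α → M} {L : Set (ℕ → α)} (h : Recognizes φ L)
    (hG : L ∈ GDelta α) {s e : M} (hse : AcceptingPair φ L s e) (he : e * e = e)
    {w : ℕ → α} {t : ℕ → ℕ} (ht : StrictMono t) (ht0 : t 0 = 0)
    (hs : ∀ i, value φ (factor w 0 (t (i + 1))) = s)
    (hf : ∀ i, ∃ z x : List α, x ≠ [] ∧ value φ x = e ∧
      value φ (factor w (t (i + 1)) (t (i + 2))) = value φ z * value φ x) : w ∈ L := by
  obtain ⟨O, hO, hL⟩ := mem_GDelta_iff.1 hG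
  have extend : ∀ i (p : List α), ∃ v : List α, v ≠ [] ∧ (value φ p = s →
      value φ v = value φ (factor w (t (i + 1)) (t (i + 2))) ∧
        ∀ w', factor w' 0 (p ++ v).length = p ++ v → w' ∈ O i) := by
    intro i p
    obtain ⟨z, x, hx, hxe, hzx⟩ := hf i
    by_cases hp : value φ p = s
    swap
    -- A dummy extension, so that `v` is defined and nonempty for every prefix `p`.
    · exact ⟨x, hx, fun h => absurd h hp⟩
    have hsze : value φ (p ++ z ++ x) = s := by
      rw [value_append, value_append, hp, mul_assoc, ← hzx, ← hs i,
        value_factor_mul φ w (Nat.zero_le _) (ht (by omega : i + 1 < i + 2)).le, hs, hs]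
    let P : ℕ → List α := fun n => p ++ z ++ (List.replicate n x).flatten
    have hP : ∀ n, P (n + 1) = P n ++ x := by
      intro n
      simp only [P, List.append_assoc]
      congr 2
      rw [List.replicate_succ', List.flatten_append]; simp
    obtain ⟨y, hy⟩ := exists_limit_word P (fun _ => x) hP fun _ => hx
    have hy' := factor_of_limit hP hy
    have hlt : ∀ n, (P n).length < (P (n + 1)).length := by
      intro n
      rw [hP, (List.length_append : (P n ++ x).length = _)]
      exact Nat.lt_add_of_pos_right (List.length_pos_iff.2 hx)
    have hyL : y ∈ L := by
      refine hse y (fun n => if n = 0 then 0 else (P n).length) ?_ rfl ?_ ?_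
      · refine strictMono_nat_of_lt_succ fun n => ?_
        rcases n with - | n
        · simpa using (Nat.zero_le _).trans_lt (hlt 0)
        · simpa using hlt (n + 1)
      · simp only [one_ne_zero, if_false]
        rw [hy]
        simpa [P] using hsze
      · intro n
        simp only [Nat.add_eq_zero_iff, OfNat.ofNat_ne_zero, one_ne_zero, and_false, if_false]
        rw [hy' (n + 1), hxe]
    obtain ⟨k, hk⟩ := hO i y ((hL y).1 hyL i)
    have hlen : ∀ n, n ≤ (P n).length := by
      intro n
      induction n with
      | zero => exact Nat.zero_le _
      | succ n ih => have := hlt n; omega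
    -- The word `y = p z x x x …` is in `L`, and its first `k` letters force `O i`. Cutting after `k
    -- + 1` copies of `x` keeps these letters, and by idempotence the value is that of a single
    -- copy.
    refine ⟨z ++ (List.replicate (k + 1) x).flatten, ?_, fun _ => ⟨?_, fun w' hw' => ?_⟩⟩
    · simp [List.replicate_succ, hx]
    · rw [value_append, value_replicate, hzx, hxe]
      congr 1
      exact IsIdempotentElem.pow_succ_eq k he
    · rw [← List.append_assoc] at hw'
      change factor w' 0 (P (k + 1)).length = P (k + 1) at hw'
      rw [← hy (k + 1), factor_length, Nat.sub_zero] at hw'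
      refine hk w' fun j hj => factor_zero_eq_iff.1 hw' j (hj.trans_le ?_)
      exact (Nat.le_succ k).trans (hlen (k + 1))
  choose v hv0 hv using extend
  -- The limit of these prefixes lies in every `O i`, hence in `L`, and its factors have the same
  -- values as those of `w`; recognition carries membership back to `w`.
  let p : ℕ → List α := fun n => Nat.rec (factor w 0 (t 1)) (fun i q => q ++ v i q) n
  have hp : ∀ i, p (i + 1) = p i ++ v i (p i) := fun i => rfl
  have hps : ∀ i, value φ (p i) = s := by
    intro i
    induction i with
    | zero => exact hs 0
    | succ i ih =>
      rw [hp, value_append, (hv i (p i) ih).1, ih, ← hs i,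
        value_factor_mul φ w (Nat.zero_le _) (ht (by omega : i + 1 < i + 2)).le, hs, hs]
  obtain ⟨w', hw'⟩ := exists_limit_word p (fun i => v i (p i)) hp fun i => hv0 i (p i)
  have hfac := factor_of_limit hp hw'
  have hw'L : w' ∈ L := (hL w').2 fun i => (hv i (p i) (hps i)).2 w' (hw' (i + 1))
  have hlt : ∀ n, (p n).length < (p (n + 1)).length := by
    intro n
    rw [hp, List.length_append]
    have := List.length_pos_iff.2 (hv0 n (p n))
    omega
  refine h w' w (fun n => Nat.casesOn n 0 fun i => (p i).length) t ?_ ht rfl ht0 ?_ hw'L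
  · refine strictMono_nat_of_lt_succ fun n => ?_
    rcases n with - | n
    · change 0 < (factor w 0 (t 1)).length
      rw [factor_length, Nat.sub_zero, ← ht0]
      exact ht one_pos
    · exact hlt n
  · rintro (- | i)
    · change value φ (factor w' 0 (p 0).length) = _
      rw [hw', hps, ht0, hs]
    · change value φ (factor w' (p i).length (p (i + 1)).length) = _
      rw [hfac, (hv i (p i) (hps i)).1]

/-! ### The detecting automaton of a recognized Gδ language -/

section ResetAutomaton

variable (φ : α → M) (L : Set (ℕ → α))

/-- The pair `(s, e)` is detected: the value of the prefix read so far is `s`, and the word read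
since the last detection of `(s, e)` has a value that ends in `e`. -/
def Detects (x : M × (M × M → M)) (i : M × M) : Prop :=
  x.1 = i.1 ∧ AcceptingPair φ L i.1 i.2 ∧ i.2 * i.2 = i.2 ∧
    ∃ z y : List α, y ≠ [] ∧ value φ y = i.2 ∧ x.2 i = value φ z * value φ y

open Classical in
/-- The automaton that computes the value of the prefix and, for each pair `(s, e)`, the value of
the word read since the last detection of `(s, e)`. -/
noncomputable def detectStep (x : M × (M × M → M)) (a : α) : M × (M × M → M) :=
  (x.1 * φ a, fun i => (if Detects φ L x i then 1 else x.2 i) * φ a)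

variable {φ L}

theorem stateAfter_detectStep_fst (w : ℕ → α) (n : ℕ) :
    (stateAfter (detectStep φ L) 1 w n).1 = value φ (factor w 0 n) := by
  induction n with
  | zero => simp [stateAfter, factor_self]
  | succ n ih =>
    rw [factor_succ w n.zero_le, value_append, ← ih, value_singleton]
    rfl

theorem exists_stateAfter_detectStep_snd (w : ℕ → α) (i : M × M) (n : ℕ) :
    ∃ m ≤ n, (stateAfter (detectStep φ L) 1 w n).2 i = value φ (factor w m n) := by
  induction n with
  | zero => exact ⟨0, le_rfl, by simp [stateAfter, factor_self]⟩
  | succ n ih =>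
    by_cases h : Detects φ L (stateAfter (detectStep φ L) 1 w n) i
    · refine ⟨n, n.le_succ, ?_⟩
      simp [stateAfter, detectStep, h, factor_succ, factor_self]
    · obtain ⟨m, hm, hd⟩ := ih
      refine ⟨m, hm.trans n.le_succ, ?_⟩
      simp [stateAfter, detectStep, h, factor_succ w hm, value_append, hd]

theorem stateAfter_detectStep_snd_of_not_detects (w : ℕ → α) (i : M × M) {k n : ℕ} (hkn : k ≤ n)
    (h : ∀ j, k ≤ j → j < n → ¬ Detects φ L (stateAfter (detectStep φ L) 1 w j) i) :
    (stateAfter (detectStep φ L) 1 w n).2 i =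
      (stateAfter (detectStep φ L) 1 w k).2 i * value φ (factor w k n) := by
  induction n, hkn using Nat.le_induction with
  | base => simp [factor_self]
  | succ n hkn ih =>
    have hn := h n hkn n.lt_succ_self
    rw [factor_succ w hkn, value_append, ← mul_assoc, ← ih fun j h1 h2 => h j h1 (by omega)]
    simp [stateAfter, detectStep, hn]

/-- The detection at `k` resets the register, so the last reset `m` before `n` is no earlier than
`k`. Hence a factor ending in `e` fits between two chosen detections, even if others lie in between.
-/
theorem exists_stateAfter_detectStep_of_detects (w : ℕ → α) (i : M × M) {k n : ℕ} (hkn : k < n)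
    (h : Detects φ L (stateAfter (detectStep φ L) 1 w k) i) :
    ∃ m, k ≤ m ∧ m < n ∧
      (stateAfter (detectStep φ L) 1 w n).2 i = value φ (factor w m n) := by
  induction n, (show k + 1 ≤ n from hkn) using Nat.le_induction with
  | base =>
    refine ⟨k, le_rfl, k.lt_succ_self, ?_⟩
    simp [stateAfter, detectStep, h, factor_succ, factor_self]
  | succ n hkn' ih =>
    by_cases hd : Detects φ L (stateAfter (detectStep φ L) 1 w n) i
    · refine ⟨n, by omega, n.lt_succ_self, ?_⟩
      simp [stateAfter, detectStep, hd, factor_succ, factor_self]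
    · obtain ⟨m, hm, hmn, he⟩ := ih hkn'
      refine ⟨m, hm, by omega, ?_⟩
      simp [stateAfter, detectStep, hd, factor_succ w hmn.le, value_append, he]

/-- Soundness: one of the finitely many pairs is detected infinitely often, and
`mem_of_frequently_return` applies; only here is the Gδ property needed. Completeness: the pair
given by Ramsey's theorem is detected infinitely often. -/
theorem Recognizes.stepLanguage_detectStep [Finite M] (h : Recognizes φ L) (hG : L ∈ GDelta α) :
    stepLanguage (detectStep φ L) 1 {x | ∃ i, Detects φ L x i} = L := by
  ext w
  constructor
  · intro hw
    have : ∃ i, ∃ᶠ n in atTop, Detects φ L (stateAfter (detectStep φ L) 1 w n) i := by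
      by_contra hcon
      push Not at hcon
      refine hw ?_
      filter_upwards [eventually_all.2 hcon] with n hn
      rintro ⟨i, hi⟩
      exact hn i hi
    obtain ⟨⟨s, e⟩, hi⟩ := this
    obtain ⟨ψ, hψ, hd⟩ := extraction_of_frequently_atTop hi
    have hpos : ∀ n, 0 < ψ (n + 1) := fun n => (Nat.zero_le _).trans_lt (hψ n.lt_succ_self)
    refine h.mem_of_frequently_return hG (hd 0).2.1 (hd 0).2.2.1
      (t := fun n => if n = 0 then 0 else ψ n) ?_ rfl (fun n => ?_) (fun n => ?_)
    · refine strictMono_nat_of_lt_succ fun n => ?_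
      rcases n with - | n
      · simpa using hpos 0
      · simpa using hψ (n + 1).lt_succ_self
    · simpa [stateAfter_detectStep_fst] using (hd (n + 1)).1
    · simp only [Nat.add_eq_zero_iff, OfNat.ofNat_ne_zero, one_ne_zero, and_false, if_false]
      obtain ⟨m, hm, hmn, hv⟩ := exists_stateAfter_detectStep_of_detects w (s, e)
        (hψ (n + 1).lt_succ_self) (hd (n + 1))
      obtain ⟨-, -, -, z, y, hy, hye, hzy⟩ := hd (n + 2)
      refine ⟨factor w (ψ (n + 1)) m ++ z, y, hy, hye, ?_⟩
      rw [← value_factor_mul φ w hm hmn.le, ← hv, hzy, value_append, mul_assoc]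
  · intro hw
    obtain ⟨e, τ, hτ, he, hf⟩ := exists_idempotent_factorization φ w
    have hpos : ∀ n, 0 < τ (n + 1) := fun n => (Nat.zero_le _).trans_lt (hτ n.lt_succ_self)
    have hse : ∀ n, value φ (factor w 0 (τ n)) * e = value φ (factor w 0 (τ (n + 1))) := by
      intro n
      rw [← value_factor_mul φ w (Nat.zero_le (τ n)) (hτ n.lt_succ_self).le, hf]
    have hs : ∀ n, value φ (factor w 0 (τ (n + 1))) = value φ (factor w 0 (τ 1)) := by
      intro n
      induction n with
      | zero => rfl
      | succ n ih => rw [← hse (n + 1), ← hse n, mul_assoc, he, hse, ih]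
    have hpair : AcceptingPair φ L (value φ (factor w 0 (τ 1))) e := by
      refine h.acceptingPair hw (t := fun n => if n = 0 then 0 else τ n) ?_ rfl fun n => ?_
      · refine strictMono_nat_of_lt_succ fun n => ?_
        rcases n with - | n
        · simpa using hpos 0
        · simpa using hτ (n + 1).lt_succ_self
      · simpa using hf (n + 1)
    set i : M × M := (value φ (factor w 0 (τ 1)), e) with hi
    suffices ∃ᶠ n in atTop, Detects φ L (stateAfter (detectStep φ L) 1 w n) i from
      this.mono fun n hn => ⟨i, hn⟩
    rw [frequently_atTop]
    intro N
    -- Without detections from `N` on there are no further resets, so at `τ (N + 1)` the register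
    -- holds the value of a factor that contains the whole block from `τ N`, of value `e`, as a
    -- suffix: a detection after all.
    by_contra hcon
    push Not at hcon
    obtain ⟨m, hmN, hm⟩ := exists_stateAfter_detectStep_snd (φ := φ) (L := L) w i N
    have hN : N ≤ τ N := hτ.id_le N
    have hN' : τ N < τ (N + 1) := hτ N.lt_succ_self
    refine hcon (τ (N + 1)) (hN.trans hN'.le) ⟨?_, hpair, he, factor w m (τ N),
      factor w (τ N) (τ (N + 1)), ?_, hf N, ?_⟩
    · rw [stateAfter_detectStep_fst, hs]
    · rw [← List.length_pos_iff, factor_length]; omega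
    · rw [stateAfter_detectStep_snd_of_not_detects w i (hN.trans hN'.le) fun j hj _ => hcon j hj,
        hm, value_factor_mul φ w hmN (hN.trans hN'.le),
        value_factor_mul φ w (hmN.trans hN) hN'.le]

end ResetAutomaton

theorem Recognizes.mem_FiniteDeterministic {M : Type} [Monoid M] [Finite M] {φ : α → M}
    {L : Set (ℕ → α)} (h : Recognizes φ L) (hG : L ∈ GDelta α) : L ∈ FiniteDeterministic α :=
  mem_FiniteDeterministic_iff.2
    ⟨_, inferInstance, detectStep φ L, 1, _, h.stepLanguage_detectStep hG⟩

end Recognition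

/-! ### Languages of finite Büchi automata are recognized by finite monoids -/

namespace BuchiAutomaton

variable {α Q : Type*} (A : BuchiAutomaton α Q)

/-- The backward action of a letter on sets of states that carry the information whether the
accepting set has been visited. -/
def backward (a : α) : Function.End (Set (Q × Prop)) :=
  fun S => {x | ∃ q, A.step x.1 a q ∧ (q, x.2 ∨ q ∈ A.accept) ∈ S}

/-- The letters act by preimages, so multiplication follows the reading order and a new last letter
just replaces `S` by its preimage. Visits are counted at times in `(i, j]`, so that consecutive
factors count each time once. -/
theorem mem_value_backward (w : ℕ → α) {i j : ℕ} (hij : i ≤ j) (S : Set (Q × Prop)) (p : Q)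
    (b : Prop) :
    (p, b) ∈ value A.backward (factor w i j) S ↔
      ∃ ρ : ℕ → Q, ρ i = p ∧ (∀ k, i ≤ k → k < j → A.step (ρ k) (w k) (ρ (k + 1))) ∧
        (ρ j, b ∨ ∃ k, i < k ∧ k ≤ j ∧ ρ k ∈ A.accept) ∈ S := by
  induction j, hij using Nat.le_induction generalizing S with
  | base =>
    have hfalse : ∀ ρ : ℕ → Q, (b ∨ ∃ k, i < k ∧ k ≤ i ∧ ρ k ∈ A.accept) = b := by
      intro ρ
      simp only [eq_iff_iff, or_iff_left_iff_imp]
      rintro ⟨k, h1, h2, -⟩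
      omega
    simp only [hfalse, factor_self, value_nil]
    constructor
    · exact fun h => ⟨fun _ => p, rfl, fun k h1 h2 => absurd h1 (not_le.2 h2), h⟩
    · rintro ⟨ρ, rfl, -, h⟩
      exact h
  | succ j hij ih =>
    rw [factor_succ w hij, value_append, value_singleton]
    refine (ih (A.backward (w j) S)).trans ?_
    constructor
    · rintro ⟨ρ, hρ, hstep, q, hq, hS⟩
      refine ⟨fun k => if k ≤ j then ρ k else q, by simp [hij, hρ], fun k h1 h2 => ?_, ?_⟩
      · rcases Nat.lt_or_ge k j with hk | hk
        · have h3 : k + 1 ≤ j := hk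
          simpa [hk.le, h3] using hstep k h1 hk
        · obtain rfl : k = j := by omega
          simpa using hq
      · convert hS using 2
        · simp
        · refine Iff.trans (or_congr_right ?_) or_assoc.symm
          constructor
          · rintro ⟨k, h1, h2, h3⟩
            by_cases hk : k ≤ j
            · exact Or.inl ⟨k, h1, hk, by simpa [hk] using h3⟩
            · exact Or.inr (by simpa [hk] using h3)
          · rintro (⟨k, h1, h2, h3⟩ | h)
            · exact ⟨k, h1, h2.trans j.le_succ, by simpa [h2] using h3⟩
            · exact ⟨j + 1, by omega, le_rfl, by simpa using h⟩
    · rintro ⟨ρ, hρ, hstep, hS⟩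
      refine ⟨ρ, hρ, fun k h1 h2 => hstep k h1 (by omega), ρ (j + 1),
        hstep j hij j.lt_succ_self, ?_⟩
      convert hS using 2
      refine or_assoc.trans (or_congr_right ?_)
      constructor
      · rintro (⟨k, h1, h2, h3⟩ | h)
        · exact ⟨k, h1, h2.trans j.le_succ, h3⟩
        · exact ⟨j + 1, by omega, le_rfl, h⟩
      · rintro ⟨k, h1, h2, h3⟩
        rcases Nat.lt_or_ge j k with hk | hk
        · obtain rfl : k = j + 1 := by omega
          exact Or.inr h3
        · exact Or.inl ⟨k, h1, hk, h3⟩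

/-- Equal values allow each segment of an accepting run to be replaced by a segment on the other
word with the same end states and a visit to the accepting set whenever there was one; the new
segments are glued. -/
theorem recognizes_backward : Recognizes A.backward A.language := by
  rintro w w' t t' ht ht' ht0 ht0' hval ⟨r, ⟨hr0, hr⟩, hacc⟩
  have hseg : ∀ i, ∃ ρ : ℕ → Q, ρ (t' i) = r (t i) ∧ ρ (t' (i + 1)) = r (t (i + 1)) ∧
      (∀ k, t' i ≤ k → k < t' (i + 1) → A.step (ρ k) (w' k) (ρ (k + 1))) ∧
      ((∃ k, t i < k ∧ k ≤ t (i + 1) ∧ r k ∈ A.accept) →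
        ∃ k, t' i < k ∧ k ≤ t' (i + 1) ∧ ρ k ∈ A.accept) := by
    intro i
    -- Testing the value on a singleton fixes both the end state and the visit flag.
    have h1 := (A.mem_value_backward w (ht i.lt_succ_self).le
      {(r (t (i + 1)), ∃ k, t i < k ∧ k ≤ t (i + 1) ∧ r k ∈ A.accept)} (r (t i)) False).2
        ⟨r, rfl, fun k _ _ => hr k, by simp⟩
    rw [hval i] at h1
    obtain ⟨ρ, h2, h3, h4⟩ := (A.mem_value_backward w' (ht' i.lt_succ_self).le _ _ _).1 h1
    simp only [false_or, Set.mem_singleton_iff, Prod.mk.injEq] at h4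
    exact ⟨ρ, h2, h4.1, h3, fun h => h4.2 ▸ h⟩
  choose ρ hρ0 hρ1 hρs hρa using hseg
  classical
  let idx : ℕ → ℕ := fun j => Nat.findGreatest (fun i => t' i ≤ j) j
  have hidx : ∀ i j, t' i ≤ j → j < t' (i + 1) → idx j = i := by
    intro i j h1 h2
    refine (Nat.findGreatest_eq_iff).2 ⟨(ht'.id_le i).trans h1, fun _ => h1, fun n hn _ => ?_⟩
    have := ht'.monotone (show i + 1 ≤ n from hn)
    omega
  have hex : ∀ (t : ℕ → ℕ), StrictMono t → t 0 = 0 → ∀ j, ∃ i, t i ≤ j ∧ j < t (i + 1) := by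
    intro t ht h0 j
    induction j with
    | zero => exact ⟨0, h0.le, by rw [← h0]; exact ht (by omega)⟩
    | succ j ih =>
      obtain ⟨i, h1, h2⟩ := ih
      rcases Nat.lt_or_ge (j + 1) (t (i + 1)) with h | h
      · exact ⟨i, by omega, h⟩
      · exact ⟨i + 1, h, by have := ht (show i + 1 < i + 1 + 1 by omega); omega⟩
  let r' : ℕ → Q := fun j => ρ (idx j) j
  have hr' : ∀ i j, t' i ≤ j → j ≤ t' (i + 1) → r' j = ρ i j := by
    intro i j h1 h2
    rcases h2.lt_or_eq with h2 | rfl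
    · simp only [r', hidx i j h1 h2]
    · simp only [r', hidx (i + 1) _ le_rfl (ht' (i + 1).lt_succ_self), hρ0, hρ1]
  refine ⟨r', ⟨?_, fun j => ?_⟩, ?_⟩
  · have := hr' 0 (t' 0) le_rfl (ht' one_pos).le
    rw [hρ0, ht0, ht0', hr0] at this
    exact this
  · obtain ⟨i, h1, h2⟩ := hex t' ht' ht0' j
    rw [hr' i j h1 h2.le, hr' i (j + 1) (by omega) h2]
    exact hρs i j h1 h2
  · rw [frequently_atTop] at hacc ⊢
    intro N
    obtain ⟨n, hn, hrn⟩ := hacc (t N + 1)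
    -- `n - 1` because visits are counted in `(t i, t (i + 1)]`, whereas `hex` locates points in `[t
    -- i, t (i + 1))`.
    obtain ⟨i, h1, h2⟩ := hex t ht ht0 (n - 1)
    have hNi : N ≤ i := by
      by_contra hlt
      have := ht.monotone (show i + 1 ≤ N by omega)
      omega
    obtain ⟨k, h3, h4, h5⟩ := hρa i ⟨n, by omega, by omega, hrn⟩
    refine ⟨k, ?_, by rwa [hr' i k h3.le h4]⟩
    have := ht'.id_le i
    simp only [id_eq] at this
    omega

end BuchiAutomaton

/-! ### Regular Gδ languages -/

section Landweber

variable {α : Type*}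

theorem exists_recognizes_of_mem_Regular {L : Set (ℕ → α)} (hL : L ∈ Regular α) :
    ∃ (M : Type) (_ : Monoid M) (_ : Finite M) (φ : α → M), Recognizes φ L := by
  obtain ⟨Q, hQ, A, rfl⟩ := hL
  exact ⟨Function.End (Set (Q × Prop)), inferInstance,
    inferInstanceAs (Finite (Set (Q × Prop) → Set (Q × Prop))), A.backward, A.recognizes_backward⟩

/-- Landweber's theorem. -/
theorem Regular_inter_GDelta_subset : Regular α ∩ GDelta α ⊆ FiniteDeterministic α := by
  rintro L ⟨hR, hG⟩
  obtain ⟨M, _, _, φ, h⟩ := exists_recognizes_of_mem_Regular hR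
  exact h.mem_FiniteDeterministic hG

theorem Regular_inter_Deterministic_eq :
    Regular α ∩ Deterministic α = FiniteDeterministic α :=
  Set.Subset.antisymm
    (fun _ h => Regular_inter_GDelta_subset ⟨h.1, Deterministic_subset_GDelta h.2⟩)
    FiniteDeterministic_subset

end Landweber

/-! ### Measures on sequences of states -/

section SequenceMeasures

variable {Q : Type*}

theorem frequently_cons_iff (F : Set Q) (q : Q) (r : ℕ → Q) :
    (∃ᶠ n in atTop, (Nat.casesOn n q r : Q) ∈ F) ↔ ∃ᶠ n in atTop, r n ∈ F := by
  conv_lhs => rw [← Filter.map_add_atTop_eq_nat 1]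
  exact Filter.frequently_map

variable [MeasurableSpace Q] [DiscreteMeasurableSpace Q]

theorem measurableSet_eval (F : Set Q) (n : ℕ) : MeasurableSet {r : ℕ → Q | r n ∈ F} :=
  measurable_pi_apply n (MeasurableSet.of_discrete (s := F))

theorem measurableSet_cylinder (u : ℕ → Q) (n : ℕ) :
    MeasurableSet {r : ℕ → Q | ∀ i ≤ n, r i = u i} := by
  have : {r : ℕ → Q | ∀ i ≤ n, r i = u i} =
      ⋂ i, ⋂ (_ : i ≤ n), {r : ℕ → Q | r i ∈ ({u i} : Set Q)} := by
    ext r; simp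
  rw [this]
  exact .iInter fun i => .iInter fun _ => measurableSet_eval _ i

theorem measurableSet_frequently (F : Set Q) :
    MeasurableSet {r : ℕ → Q | ∃ᶠ n in atTop, r n ∈ F} := by
  have : {r : ℕ → Q | ∃ᶠ n in atTop, r n ∈ F} = ⋂ m, ⋃ n ≥ m, {r : ℕ → Q | r n ∈ F} := by
    ext r; simp [frequently_atTop]
  rw [this]
  exact .iInter fun m => .iUnion fun n => .iUnion fun _ => measurableSet_eval F n

theorem measurableSet_avoid (F : Set Q) (m : ℕ) :
    MeasurableSet {r : ℕ → Q | ∀ n ≥ m, r n ∉ F} := by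
  have : {r : ℕ → Q | ∀ n ≥ m, r n ∉ F} = ⋂ n, ⋂ (_ : n ≥ m), {r : ℕ → Q | r n ∈ F}ᶜ := by
    ext r; simp
  rw [this]
  exact .iInter fun n => .iInter fun _ => (measurableSet_eval F n).compl

variable [Finite Q]

theorem map_frestrictLe_ext {μ ν : Measure (ℕ → Q)} {n : ℕ}
    (h : ∀ u : ℕ → Q, μ {r | ∀ i ≤ n, r i = u i} = ν {r | ∀ i ≤ n, r i = u i}) :
    μ.map (Preorder.frestrictLe n) = ν.map (Preorder.frestrictLe n) := by
  refine Measure.ext_of_singleton fun a => ?_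
  -- The finite sequence `a` is continued by its last entry; the values beyond `n` play no role in
  -- the cylinder.
  have hs : Preorder.frestrictLe (π := fun _ => Q) n ⁻¹' {a} = {r | ∀ i ≤ n, r i =
      (fun i => if hi : i ≤ n then a ⟨i, Finset.mem_Iic.2 hi⟩
        else a ⟨n, Finset.mem_Iic.2 le_rfl⟩ : ℕ → Q) i} := by
    ext r
    simp only [Set.mem_preimage, Set.mem_singleton_iff, funext_iff, Subtype.forall,
      Finset.mem_Iic, Preorder.frestrictLe_apply, Set.mem_ofPred_eq]
    exact forall_congr' fun i => forall_congr' fun hi => by simp [hi]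
  rw [Measure.map_apply (by fun_prop) (measurableSet_singleton a),
    Measure.map_apply (by fun_prop) (measurableSet_singleton a), hs, h]

theorem measure_ext_of_cylinder {μ ν : Measure (ℕ → Q)} [IsFiniteMeasure ν]
    (h : ∀ (u : ℕ → Q) n, μ {r | ∀ i ≤ n, r i = u i} = ν {r | ∀ i ≤ n, r i = u i}) : μ = ν := by
  have hν : IsProjectiveLimit ν fun I : Finset ℕ => ν.map I.restrict := fun _ => rfl
  refine IsProjectiveLimit.unique (P := fun I : Finset ℕ => ν.map I.restrict) ?_ hν
  rw [isProjectiveLimit_nat_iff]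
  · exact fun n => map_frestrictLe_ext fun u => h u n
  · intro I J hJI
    rw [Measure.map_map (by fun_prop) (by fun_prop)]
    rfl

end SequenceMeasures

/-! ### The run measure of a probabilistic automaton -/

namespace PBA

variable {α Q : Type*}

/-- The automaton `B` with initial state `q`. -/
def startAt (B : PBA α Q) (q : Q) : PBA α Q := { B with start := q }

/-- The runs of the chain put behind the state `q`. -/
def cons (q : Q) (r : ℕ → Q) : ℕ → Q := fun n => Nat.casesOn n q r

section Measurable

variable [MeasurableSpace Q]

theorem measurable_cons (q : Q) : Measurable (cons q) := by
  refine measurable_pi_lambda _ fun n => ?_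
  cases n with
  | zero => exact measurable_const
  | succ n => exact measurable_pi_apply n

variable [Finite Q] [DiscreteMeasurableSpace Q] (B : PBA α Q)

theorem runMeasure_map_frestrictLe_congr {w w' : ℕ → α} {n : ℕ} (h : ∀ i < n, w' i = w i) :
    (B.runMeasure w').map (Preorder.frestrictLe n) =
      (B.runMeasure w).map (Preorder.frestrictLe n) := by
  refine map_frestrictLe_ext fun u => ?_
  rw [runMeasure_cylinder, runMeasure_cylinder]
  congr 1
  exact Finset.prod_congr rfl fun i hi => by rw [h i (Finset.mem_range.1 hi)]

/-- The probability of visiting `F` between the times `m` and `k` depends on the first `k` letters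
only. -/
theorem runMeasure_visit_congr (F : Set Q) {w w' : ℕ → α} (m : ℕ) {k : ℕ}
    (h : ∀ i < k, w' i = w i) :
    B.runMeasure w' {r | ∃ n, m ≤ n ∧ n ≤ k ∧ r n ∈ F} =
      B.runMeasure w {r | ∃ n, m ≤ n ∧ n ≤ k ∧ r n ∈ F} := by
  have hs : {r : ℕ → Q | ∃ n, m ≤ n ∧ n ≤ k ∧ r n ∈ F} = Preorder.frestrictLe (π := fun _ => Q) k ⁻¹'
      {x | ∃ n, ∃ hn : n ≤ k, m ≤ n ∧ x ⟨n, Finset.mem_Iic.2 hn⟩ ∈ F} := by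
    ext r
    simp only [Set.mem_ofPred_eq, Set.mem_preimage, Preorder.frestrictLe_apply, exists_prop]
    exact exists_congr fun n => and_left_comm
  have hm := (Set.toFinite {x : (Finset.Iic k → Q) |
    ∃ n, ∃ hn : n ≤ k, m ≤ n ∧ x ⟨n, Finset.mem_Iic.2 hn⟩ ∈ F}).measurableSet
  rw [hs, ← Measure.map_apply (by fun_prop) hm, ← Measure.map_apply (by fun_prop) hm,
    runMeasure_map_frestrictLe_congr B h]

/-- Continuity of the measure from above in `m` and from below in `k`. -/
theorem measure_frequently_eq_iInf_iSup (F : Set Q) (w : ℕ → α) :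
    B.runMeasure w {r | ∃ᶠ n in atTop, r n ∈ F} =
      ⨅ m, ⨆ k, B.runMeasure w {r | ∃ n, m ≤ n ∧ n ≤ k ∧ r n ∈ F} := by
  have h1 : ∀ m, {r : ℕ → Q | ∃ n ≥ m, r n ∈ F} =
      ⋃ k, {r | ∃ n, m ≤ n ∧ n ≤ k ∧ r n ∈ F} := by
    intro m
    ext r
    simp only [Set.mem_ofPred_eq, Set.mem_iUnion]
    exact ⟨fun ⟨n, hn, h⟩ => ⟨n, n, hn, le_rfl, h⟩, fun ⟨_, n, hn, _, h⟩ => ⟨n, hn, h⟩⟩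
  have h2 : {r : ℕ → Q | ∃ᶠ n in atTop, r n ∈ F} = ⋂ m, {r : ℕ → Q | ∃ n ≥ m, r n ∈ F} := by
    ext r; simp [frequently_atTop]
  rw [h2, Antitone.measure_iInter]
  · refine iInf_congr fun m => ?_
    rw [h1, Monotone.measure_iUnion]
    exact fun k k' hk r ⟨n, h, h', hF⟩ => ⟨n, h, h'.trans hk, hF⟩
  · exact fun m m' hm r ⟨n, hn, h⟩ => ⟨n, le_trans hm hn, h⟩
  · intro m
    have : {r : ℕ → Q | ∃ n ≥ m, r n ∈ F} = {r : ℕ → Q | ∀ n ≥ m, r n ∉ F}ᶜ := by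
      ext r; simp
    rw [this]
    exact (measurableSet_avoid F m).compl.nullMeasurableSet
  · exact ⟨0, measure_ne_top _ _⟩

/-- The Markov property at time one. -/
theorem runMeasure_startAt (q : Q) (w : ℕ → α) :
    (B.startAt q).runMeasure w = Measure.sum fun q' => B.trans q (w 0) q' •
      ((B.startAt q').runMeasure fun n => w (n + 1)).map (cons q) := by
  refine (measure_ext_of_cylinder fun u n => ?_).symm
  have hm := measurableSet_cylinder u n
  rw [runMeasure_cylinder, Measure.sum_apply _ hm]
  simp only [Measure.smul_apply, smul_eq_mul, Measure.map_apply (measurable_cons q) hm]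
  by_cases hq : u 0 = q
  swap
  · have : ∀ n, cons q ⁻¹' {r : ℕ → Q | ∀ i ≤ n, r i = u i} = ∅ := by
      intro n
      ext r
      simp only [Set.mem_preimage, Set.mem_ofPred_eq, Set.mem_empty_iff_false, iff_false]
      exact fun h => hq (h 0 (Nat.zero_le _)).symm
    simp [this, startAt, hq]
  cases n with
  | zero =>
    have : cons q ⁻¹' {r : ℕ → Q | ∀ i ≤ 0, r i = u i} = Set.univ := by
      ext r
      simp [cons, hq]
    simp only [this, measure_univ, mul_one, PMF.tsum_coe]
    simp [startAt, hq]
  | succ n =>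
    have : cons q ⁻¹' {r : ℕ → Q | ∀ i ≤ n + 1, r i = u i} =
        {r : ℕ → Q | ∀ i ≤ n, r i = u (i + 1)} := by
      ext r
      simp only [Set.mem_preimage, Set.mem_ofPred_eq]
      constructor
      · exact fun h i hi => h (i + 1) (by omega)
      · rintro h (- | i) hi
        · exact hq.symm
        · exact h i (by omega)
    simp only [this, runMeasure_cylinder (B.startAt _) _ (fun i => u (i + 1))]
    rw [tsum_eq_single (u 1), Finset.prod_range_succ']
    · simp [startAt, hq, mul_comm]
    · intro q' hq'
      simp [startAt, hq'.symm]

theorem runMeasure_startAt_apply (q : Q) (w : ℕ → α) {E : Set (ℕ → Q)} (hE : MeasurableSet E) :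
    (B.startAt q).runMeasure w E = ∑' q', B.trans q (w 0) q' *
      (B.startAt q').runMeasure (fun n => w (n + 1)) (cons q ⁻¹' E) := by
  rw [runMeasure_startAt, Measure.sum_apply _ hE]
  simp only [Measure.smul_apply, smul_eq_mul, Measure.map_apply (measurable_cons q) hE]

/-- A bound on the probability of an event that is uniform in the state at time `m` holds for the
event shifted by `m`. -/
theorem runMeasure_shift_le {E : Set (ℕ → Q)} (hE : MeasurableSet E) {c : ℝ≥0∞} (m : ℕ)
    (w : ℕ → α) (h : ∀ q, (B.startAt q).runMeasure (fun n => w (n + m)) E ≤ c) (q : Q) :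
    (B.startAt q).runMeasure w {r | (fun n => r (n + m)) ∈ E} ≤ c := by
  induction m generalizing w q with
  | zero => exact h q
  | succ m ih =>
    have hm : ∀ m, MeasurableSet {r : ℕ → Q | (fun n => r (n + m)) ∈ E} := fun m =>
      (measurable_pi_lambda _ fun n => measurable_pi_apply (n + m)) hE
    rw [runMeasure_startAt_apply B q w (hm (m + 1))]
    calc _ ≤ ∑' q', B.trans q (w 0) q' * c := by
          refine ENNReal.tsum_le_tsum fun q' => mul_le_mul_right ?_ _
          exact ih (fun n => w (n + 1)) h q'
      _ = c := by rw [ENNReal.tsum_mul_right, PMF.tsum_coe, one_mul]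

theorem runMeasure_avoid_eq_zero {q : Q} (hq : q ∈ B.final) (w : ℕ → α) :
    (B.startAt q).runMeasure w {r | ∀ n ≥ 0, r n ∉ B.final} = 0 := by
  rw [runMeasure_startAt_apply B q w (measurableSet_avoid _ 0)]
  have : cons q ⁻¹' {r : ℕ → Q | ∀ n ≥ 0, r n ∉ B.final} = ∅ := by
    ext r
    simp only [Set.mem_preimage, Set.mem_ofPred_eq, Set.mem_empty_iff_false, iff_false]
    exact fun h => h 0 le_rfl hq
  rw [this]
  simp

theorem runMeasure_avoid {q : Q} (hq : q ∉ B.final) (w : ℕ → α) :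
    (B.startAt q).runMeasure w {r | ∀ n ≥ 0, r n ∉ B.final} = ∑' q', B.trans q (w 0) q' *
      (B.startAt q').runMeasure (fun n => w (n + 1)) {r | ∀ n ≥ 0, r n ∉ B.final} := by
  rw [runMeasure_startAt_apply B q w (measurableSet_avoid _ 0)]
  have : cons q ⁻¹' {r : ℕ → Q | ∀ n ≥ 0, r n ∉ B.final} = {r | ∀ n ≥ 0, r n ∉ B.final} := by
    ext r
    constructor
    · exact fun h n _ => h (n + 1) (Nat.zero_le _)
    · rintro h (- | n) -
      · exact hq
      · exact h n (Nat.zero_le _)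
  rw [this]

/-- A cylinder has mass one if it follows the deterministic run; otherwise the factor at the first
deviation vanishes. -/
theorem runMeasure_pure (δ : Q → α → Q) (q : Q) (F : Set Q) (w : ℕ → α) :
    (PBA.mk q F fun p a => PMF.pure (δ p a)).runMeasure w =
      Measure.dirac (stateAfter δ q w) := by
  refine measure_ext_of_cylinder fun u n => ?_
  rw [runMeasure_cylinder]
  by_cases h : ∀ i ≤ n, stateAfter δ q w i = u i
  · rw [Measure.dirac_apply_of_mem (by exact h), Set.indicator_of_mem, Finset.prod_eq_one]
    · simp
    · intro i hi
      rw [Finset.mem_range] at hi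
      have h1 := h i hi.le
      have h2 := h (i + 1) hi
      rw [stateAfter, h1] at h2
      simp [h2]
    · exact (h 0 n.zero_le).symm
  · have hd : Measure.dirac (stateAfter δ q w) {r | ∀ i ≤ n, r i = u i} = 0 := by
      rw [Measure.dirac_apply' _ (measurableSet_cylinder u n)]
      exact Set.indicator_of_notMem (by exact h) _
    rw [hd]
    classical
    push Not at h
    obtain ⟨hi, hne⟩ := Nat.find_spec h
    have hmin := fun j => Nat.find_min (H := h) (m := j)
    generalize Nat.find h = i at hi hne hmin
    rcases i with - | i
    · rw [Set.indicator_of_notMem, zero_mul]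
      exact fun h => hne (Set.mem_singleton_iff.1 h).symm
    · have h1 : stateAfter δ q w i = u i := by
        by_contra h1
        exact hmin i i.lt_succ_self ⟨by omega, h1⟩
      rw [stateAfter, h1] at hne
      rw [Finset.prod_eq_zero (Finset.mem_range.2 hi), mul_zero]
      simp [hne.symm]

end Measurable

/-! ### Languages of probabilistic automata -/

variable [Finite Q] (B : PBA α Q)

/-- The closed condition `≥ x` is the conjunction of strict bounds by the rationals below `x`, one
family for each `m`; each strict bound is witnessed by a finite window. -/
theorem cutpointLanguage_mem_GDelta (x : ℝ) : B.cutpointLanguage x ∈ GDelta α := by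
  let _ : MeasurableSpace Q := ⊤
  refine mem_GDelta_of_countable (ι := ℕ × ℚ) (fun mq => {w | Real.toNNReal mq.2 < ENNReal.ofReal x →
    ∃ k, (Real.toNNReal mq.2 : ℝ≥0∞) <
      B.runMeasure w {r | ∃ n, mq.1 ≤ n ∧ n ≤ k ∧ r n ∈ B.final}}) ?_ fun w => ?_
  · rintro ⟨m, q⟩ w hw
    by_cases hq : (Real.toNNReal q : ℝ≥0∞) < ENNReal.ofReal x
    · obtain ⟨k, hk⟩ := hw hq
      exact ⟨k, fun w' h _ => ⟨k, by rwa [runMeasure_visit_congr B _ _ h]⟩⟩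
    · exact ⟨0, fun w' _ h => absurd h hq⟩
  · have h1 : w ∈ B.cutpointLanguage x ↔
        ENNReal.ofReal x ≤ B.runMeasure w {r | ∃ᶠ n in atTop, r n ∈ B.final} :=
      (ENNReal.ofReal_le_iff_le_toReal (measure_ne_top _ _)).symm
    rw [h1, measure_frequently_eq_iInf_iSup, le_iInf_iff]
    simp only [Prod.forall, Set.mem_ofPred_eq]
    refine forall_congr' fun m => ?_
    simp only [← lt_iSup_iff]
    constructor
    · exact fun h q hq => hq.trans_le h
    · intro h
      refine le_of_forall_lt fun c hc => ?_
      obtain ⟨q, -, h2, h3⟩ := ENNReal.lt_iff_exists_rat_btwn.1 hc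
      exact h2.trans (h q h3)

theorem acceptProb_le_one (w : ℕ → α) : B.acceptProb w ≤ 1 := by
  let _ : MeasurableSpace Q := ⊤
  exact measureReal_le_one

theorem almostSureLanguage_eq : B.almostSureLanguage = B.cutpointLanguage 1 := by
  ext w
  exact ⟨fun h => (show B.acceptProb w = 1 from h).ge,
    fun h => (B.acceptProb_le_one w).antisymm h⟩

theorem mem_almostSureLanguage_iff [MeasurableSpace Q] [DiscreteMeasurableSpace Q] (w : ℕ → α) :
    w ∈ B.almostSureLanguage ↔ B.runMeasure w {r | ∃ᶠ n in atTop, r n ∈ B.final}ᶜ = 0 := by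
  -- `acceptProb` is defined with the σ-algebra `⊤`, which every discrete one equals.
  have htop : ‹MeasurableSpace Q› = ⊤ :=
    eq_top_iff.2 fun s _ => MeasurableSet.of_discrete (s := s)
  subst htop
  let _ : MeasurableSpace Q := ⊤
  rw [prob_compl_eq_zero_iff (measurableSet_frequently _)]
  change (B.runMeasure w {r | ∃ᶠ n in atTop, r n ∈ B.final}).toReal = 1 ↔ _
  rw [ENNReal.toReal_eq_one_iff]

/-- Rejection is a tail event, so its probability is the average over the successors, and a sum of
nonnegative terms vanishes only termwise. -/
theorem mem_almostSureLanguage_startAt_iff (q : Q) (w : ℕ → α) :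
    w ∈ (B.startAt q).almostSureLanguage ↔ ∀ q', B.trans q (w 0) q' ≠ 0 →
      (fun n => w (n + 1)) ∈ (B.startAt q').almostSureLanguage := by
  let _ : MeasurableSpace Q := ⊤
  simp only [mem_almostSureLanguage_iff]
  have hm := (measurableSet_frequently (Q := Q) B.final).compl
  have hc : cons q ⁻¹' {r : ℕ → Q | ∃ᶠ n in atTop, r n ∈ B.final}ᶜ =
      {r : ℕ → Q | ∃ᶠ n in atTop, r n ∈ B.final}ᶜ := by
    ext r
    exact not_congr (frequently_cons_iff B.final q r)
  refine (Eq.congr_left (runMeasure_startAt_apply B q w hm)).trans ?_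
  rw [hc, ENNReal.tsum_eq_zero]
  refine forall_congr' fun q' => ?_
  rw [mul_eq_zero, or_iff_not_imp_left]
  rfl

/-- The states reached with positive probability from a set of states. -/
def supportStep (S : Set Q) (a : α) : Set Q := {q' | ∃ q ∈ S, B.trans q a q' ≠ 0}

theorem forall_mem_almostSureLanguage_iff (S : Set Q) (w : ℕ → α) (n : ℕ) :
    (∀ q ∈ S, w ∈ (B.startAt q).almostSureLanguage) ↔
      ∀ q ∈ stateAfter B.supportStep S w n,
        (fun i => w (n + i)) ∈ (B.startAt q).almostSureLanguage := by
  induction n with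
  | zero => simp [stateAfter]
  | succ n ih =>
    rw [ih]
    simp only [B.mem_almostSureLanguage_startAt_iff _ (fun i => w (n + i))]
    have : (fun i => w (n + (i + 1))) = fun i => w (n + 1 + i) := by
      funext i; congr 1; omega
    simp only [this, stateAfter, supportStep, Set.mem_ofPred_eq, add_zero]
    exact ⟨fun h q' ⟨q, hq, hq'⟩ => h q hq q' hq', fun h q hq q' hq' => h q' ⟨q, hq, hq'⟩⟩

/-- Two positions `i < j` have the same support set. Following the prefix of length `j` by the tail
from `i` therefore gives an accepted word again, which must be `w`. -/
theorem exists_period_of_almostSureLanguage_eq_singleton {w : ℕ → α}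
    (h : B.almostSureLanguage = {w}) : ∃ i j, i < j ∧ ∀ n, w (j + n) = w (i + n) := by
  obtain ⟨i, j, hij, hS⟩ : ∃ i j, i < j ∧
      stateAfter B.supportStep {B.start} w i = stateAfter B.supportStep {B.start} w j := by
    obtain ⟨i, j, hne, hS⟩ :=
      Finite.exists_ne_map_eq_of_infinite (stateAfter B.supportStep {B.start} w)
    rcases hne.lt_or_gt with h | h
    exacts [⟨i, j, h, hS⟩, ⟨j, i, h, hS.symm⟩]
  refine ⟨i, j, hij, fun n => ?_⟩
  have hmem : ∀ v, v ∈ B.almostSureLanguage ↔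
      ∀ q ∈ ({B.start} : Set Q), v ∈ (B.startAt q).almostSureLanguage := by
    simp [startAt]
  let v : ℕ → α := fun n => if n < j then w n else w (i + (n - j))
  have hv : v ∈ B.almostSureLanguage := by
    rw [hmem, B.forall_mem_almostSureLanguage_iff _ v j,
      stateAfter_congr B.supportStep {B.start} (w := w) fun k hk => by simp [v, hk], ← hS]
    have : (fun n => v (j + n)) = fun n => w (i + n) := by funext n; simp [v]
    rw [this, ← B.forall_mem_almostSureLanguage_iff _ w i, ← hmem, h]
    rfl
  rw [h, Set.mem_singleton_iff] at hv
  have := congrFun hv (j + n)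
  simpa [v] using this.symm

/-- A rejecting run avoids the final states from some `m` on, hence from any later `m'`; if this is
null from every state at `m'`, countably many null events remain. -/
theorem mem_almostSureLanguage_of_avoid [MeasurableSpace Q] [DiscreteMeasurableSpace Q]
    (w : ℕ → α) (h : ∀ m, ∃ m' ≥ m, ∀ q,
      (B.startAt q).runMeasure (fun n => w (n + m')) {r | ∀ n ≥ 0, r n ∉ B.final} = 0) :
    w ∈ B.almostSureLanguage := by
  rw [mem_almostSureLanguage_iff]
  have hU : {r : ℕ → Q | ∃ᶠ n in atTop, r n ∈ B.final}ᶜ = ⋃ m, {r | ∀ n ≥ m, r n ∉ B.final} := by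
    ext r; simp [frequently_atTop]
  rw [hU]
  refine measure_iUnion_null fun m => ?_
  obtain ⟨m', hm, h0⟩ := h m
  refine measure_mono_null (fun r hr => ?_) (nonpos_iff_eq_zero.1
    (B.runMeasure_shift_le (measurableSet_avoid B.final 0) m' w (fun q => (h0 q).le) B.start))
  exact fun n _ => hr (n + m') (by omega)

end PBA

/-! ### Almost-sure languages between finite deterministic and Gδ languages -/

section Classes

variable {α : Type*}

theorem AlmostSure_subset_GDelta : AlmostSure α ⊆ GDelta α := by
  rintro _ ⟨Q, _, B, rfl⟩
  rw [PBA.almostSureLanguage_eq]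
  exact B.cutpointLanguage_mem_GDelta 1

theorem FiniteDeterministic_subset_AlmostSure : FiniteDeterministic α ⊆ AlmostSure α := by
  intro L hL
  obtain ⟨Q, hQ, δ, q, F, rfl⟩ := mem_FiniteDeterministic_iff.1 hL
  refine ⟨Q, hQ, ⟨q, F, fun p a => PMF.pure (δ p a)⟩, ?_⟩
  let _ : MeasurableSpace Q := ⊤
  ext w
  rw [PBA.mem_almostSureLanguage_iff, PBA.runMeasure_pure,
    Measure.dirac_apply' _ (measurableSet_frequently F).compl]
  rw [Set.indicator_apply_eq_zero]
  simp only [Set.mem_compl_iff, Set.mem_ofPred_eq, Pi.one_apply, one_ne_zero, imp_false, not_not]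
  rfl

/-- The witness is a single word that is not eventually periodic: `b` stands exactly at the powers
of two. -/
theorem exists_mem_GDelta_notMem_AlmostSure [Nontrivial α] :
    ∃ L ∈ GDelta α, L ∉ AlmostSure α := by
  classical
  obtain ⟨a, b, hab⟩ := exists_pair_ne α
  refine ⟨{fun n => if ∃ k, n = 2 ^ k then b else a}, singleton_mem_GDelta _, ?_⟩
  rintro ⟨Q, _, B, hB⟩
  obtain ⟨i, j, hij, h⟩ := B.exists_period_of_almostSureLanguage_eq_singleton hB
  have hj : j < 2 ^ j := Nat.lt_two_pow_self
  -- The period `j - i` moves the letter `b` at `2 ^ j` to a position strictly between `2 ^ j` and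
  -- `2 ^ (j + 1)`.
  have h1 := h (2 ^ j - i)
  have h2 : i + (2 ^ j - i) = 2 ^ j := by omega
  rw [h2] at h1
  simp only [exists_apply_eq_apply', if_true, ite_eq_left_iff] at h1
  refine hab (h1 ?_)
  rintro ⟨k, hk⟩
  rcases Nat.lt_or_ge j k with hjk | hjk
  · have := Nat.pow_le_pow_right (n := 2) (by norm_num) (show j + 1 ≤ k from hjk)
    rw [pow_succ] at this
    omega
  · have := Nat.pow_le_pow_right (n := 2) (by norm_num) hjk
    omega

end Classes

/-! ### An almost-sure language that is not regular -/

section BlockWords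

variable {α : Type*}

open Classical in
/-- The word `a … ab a … ab …` whose `i`-th block occupies the positions from `t i` to
`t (i + 1)`. -/
noncomputable def blockWord (a b : α) (t : ℕ → ℕ) (n : ℕ) : α :=
  if ∃ i, n + 1 = t (i + 1) then b else a

variable {a b : α} {t : ℕ → ℕ}

theorem blockWord_of_lt (ht : StrictMono t) {i n : ℕ} (h1 : t i ≤ n) (h2 : n + 1 < t (i + 1)) :
    blockWord a b t n = a := by
  refine if_neg ?_
  rintro ⟨j, hj⟩
  have h3 : i < j + 1 := ht.lt_iff_lt.1 (by omega)
  have h4 : j + 1 < i + 1 := ht.lt_iff_lt.1 (by omega)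
  omega

theorem blockWord_last {i n : ℕ} (h : n + 1 = t (i + 1)) : blockWord a b t n = b :=
  if_pos ⟨i, h⟩

theorem factor_blockWord (ht : StrictMono t) {i k : ℕ} (h : t (i + 1) = t i + (k + 1)) :
    factor (blockWord a b t) (t i) (t (i + 1)) = List.replicate k a ++ [b] := by
  rw [h, ← add_assoc, factor_succ _ (Nat.le_add_right _ _),
    blockWord_last (show t i + k + 1 = t (i + 1) by omega)]
  congr 1
  refine List.eq_replicate_iff.2 ⟨by simp [factor_length], fun c hc => ?_⟩
  obtain ⟨n, hn, rfl⟩ := List.mem_map.1 hc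
  rw [List.Ico.mem] at hn
  exact blockWord_of_lt ht hn.1 (by omega)

end BlockWords

section CoinAutomaton

variable {α : Type*}

open Classical in
/-- In a block of letters `a` a fair coin is thrown at every letter; the state `some true` means
that all of them came up heads, `some false` that some came up tails. Any other letter ends the
block; the final state `none` is entered if all coins came up heads. -/
noncomputable def coinAutomaton (a : α) : PBA α (Option Bool) where
  start := some true
  final := {none}
  trans q c :=
    if c = a then
      if q = some false then PMF.pure (some false) else (PMF.uniformOfFintype Bool).map some
    else if q = some false then PMF.pure (some true) else PMF.pure none

variable {a c : α}

theorem tsum_pure_mul {Q : Type*} (q : Q) (g : Q → ℝ≥0∞) :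
    ∑' q', PMF.pure q q' * g q' = g q := by
  rw [tsum_eq_single q]
  · simp
  · intro q' hq'
    simp [hq']

theorem coinAutomaton_tails (hc : c = a) (g : Option Bool → ℝ≥0∞) :
    ∑' q', (coinAutomaton a).trans (some false) c q' * g q' = g (some false) := by
  simp only [coinAutomaton, hc, if_true]
  exact tsum_pure_mul _ g

theorem coinAutomaton_heads (hc : c = a) {q : Option Bool} (hq : q ≠ some false)
    (g : Option Bool → ℝ≥0∞) :
    ∑' q', (coinAutomaton a).trans q c q' * g q' = 2⁻¹ * g (some true) + 2⁻¹ * g (some false) := by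
  simp only [coinAutomaton, hc, hq, if_true, if_false]
  rw [tsum_fintype]
  simp [Fintype.sum_option, PMF.map_apply]

theorem coinAutomaton_end_tails (hc : c ≠ a) (g : Option Bool → ℝ≥0∞) :
    ∑' q', (coinAutomaton a).trans (some false) c q' * g q' = g (some true) := by
  simp only [coinAutomaton, hc, if_true, if_false]
  exact tsum_pure_mul _ g

theorem coinAutomaton_end_heads (hc : c ≠ a) {q : Option Bool} (hq : q ≠ some false)
    (g : Option Bool → ℝ≥0∞) :
    ∑' q', (coinAutomaton a).trans q c q' * g q' = g none := by
  simp only [coinAutomaton, hc, hq, if_false]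
  exact tsum_pure_mul _ g

theorem ENNReal.half_add_half_lt {x y : ℝ≥0∞} (h : y < x) (hx : x ≠ ∞) :
    2⁻¹ * y + 2⁻¹ * x < x := by
  calc 2⁻¹ * y + 2⁻¹ * x < 2⁻¹ * x + 2⁻¹ * x := by
        refine ENNReal.add_lt_add_right (ENNReal.mul_ne_top (by simp) hx) ?_
        exact (ENNReal.mul_lt_mul_iff_right (by simp) (by simp)).2 h
    _ = x := by rw [← add_mul, ENNReal.inv_two_add_inv_two, one_mul]

/-- A word that consists of equal blocks is accepted almost surely. -/
theorem blockWord_const_mem_almostSureLanguage {b : α} (hab : a ≠ b) (k : ℕ) :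
    blockWord a b (fun i => i * (k + 1)) ∈ (coinAutomaton a).almostSureLanguage := by
  let _ : MeasurableSpace (Option Bool) := ⊤
  set t : ℕ → ℕ := fun i => i * (k + 1) with ht
  have hmono : StrictMono t := strictMono_mul_right_of_pos k.succ_pos
  set w := blockWord a b t with hw
  have hper : ∀ m, (fun n => w (n + t m)) = w := by
    intro m
    funext n
    simp only [hw, blockWord]
    classical
    refine if_congr ⟨?_, ?_⟩ rfl rfl
    · rintro ⟨i, hi⟩
      have hi' : n + 1 + m * (k + 1) = (i + 1) * (k + 1) := by simp only [ht] at hi; omega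
      have him : m ≤ i := by
        by_contra hlt
        have := Nat.mul_le_mul_right (k + 1) (show i + 1 ≤ m by omega)
        omega
      obtain ⟨d, rfl⟩ := Nat.exists_eq_add_of_le him
      refine ⟨d, ?_⟩
      simp only [ht]
      linarith
    · rintro ⟨i, hi⟩
      refine ⟨i + m, ?_⟩
      simp only [ht] at hi ⊢
      linarith
  -- The probability of never being in the final state, starting in `q` at position `j` of the word.
  let A : ℕ → Option Bool → ℝ≥0∞ := fun j q =>
    ((coinAutomaton a).startAt q).runMeasure (fun n => w (n + j))
      {r | ∀ n ≥ 0, r n ∉ (coinAutomaton a).final}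
  have hfin : ∀ q : Option Bool, q ≠ none → q ∉ (coinAutomaton a).final := fun q hq => hq
  have hnone : ∀ j, A j none = 0 := fun j =>
    (coinAutomaton a).runMeasure_avoid_eq_zero (q := none) rfl _
  have hstep : ∀ j q, q ≠ none →
      A j q = ∑' q', (coinAutomaton a).trans q (w j) q' * A (j + 1) q' := by
    intro j q hq
    have h := (coinAutomaton a).runMeasure_avoid (hfin q hq) (fun n => w (n + j))
    simp only [zero_add, add_assoc, add_comm 1 j] at h
    exact h
  have hA0 : ∀ q, A (k + 1) q = A 0 q := by
    intro q
    simp only [A, add_zero]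
    have := hper 1
    simp only [ht, one_mul] at this
    rw [this]
  have hwa : ∀ j < k, w j = a := fun j hj =>
    blockWord_of_lt hmono (i := 0) (by simp [ht]) (by simpa [ht] using hj)
  have hwk : w k ≠ a := by
    rw [hw, blockWord_last (i := 0) (by simp [ht])]
    exact hab.symm
  have hlast : A k (some false) = A 0 (some true) := by
    rw [hstep k _ (by simp), coinAutomaton_end_tails hwk, hA0]
  have hlast' : A k (some true) = 0 := by
    rw [hstep k _ (by simp), coinAutomaton_end_heads hwk (by simp), hnone]
  have hfalse : ∀ d ≤ k, A (k - d) (some false) = A 0 (some true) := by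
    intro d
    induction d with
    | zero => exact fun _ => hlast
    | succ d ih =>
      intro hd
      rw [hstep _ _ (by simp), coinAutomaton_tails (hwa _ (by omega)),
        show k - (d + 1) + 1 = k - d by omega]
      exact ih (by omega)
  -- Backwards through the block, `A` at `some true` is the mean of its next value and of `A 0 (some
  -- true)`, and it is zero before the last letter. Were `A 0 (some true)` positive, it would be
  -- strictly smaller than itself.
  have htrue : A 0 (some true) = 0 := by
    by_contra hne
    have : ∀ d ≤ k, A (k - d) (some true) < A 0 (some true) := by
      intro d
      induction d with
      | zero => exact fun _ => by rw [Nat.sub_zero, hlast']; exact pos_iff_ne_zero.2 hne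
      | succ d ih =>
        intro hd
        rw [hstep _ _ (by simp), coinAutomaton_heads (hwa _ (by omega)) (by simp),
          show k - (d + 1) + 1 = k - d by omega, hfalse d (by omega)]
        exact ENNReal.half_add_half_lt (ih (by omega)) (measure_ne_top _ _)
    have h := this k le_rfl
    rw [Nat.sub_self] at h
    exact lt_irrefl _ h
  have hall : ∀ q, A 0 q = 0 := by
    rintro (- | - | -)
    · exact hnone 0
    · have := hfalse k le_rfl
      rwa [Nat.sub_self, htrue] at this
    · exact htrue
  refine (coinAutomaton a).mem_almostSureLanguage_of_avoid w fun m =>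
    ⟨t m, Nat.le_mul_of_pos_right m k.succ_pos, fun q => ?_⟩
  rw [hper m]
  exact hall q

section Visit

variable [MeasurableSpace (Option Bool)] [DiscreteMeasurableSpace (Option Bool)]

theorem coinAutomaton_visit_zero (w : ℕ → α) {q : Option Bool} (hq : q ≠ none) :
    ((coinAutomaton a).startAt q).runMeasure w {r | r 0 ∈ (coinAutomaton a).final} = 0 := by
  have h := ((coinAutomaton a).startAt q).runMeasure_cylinder w (fun _ => none) 0
  have hs : {r : ℕ → Option Bool | r 0 ∈ (coinAutomaton a).final} =
      {r | ∀ i ≤ 0, r i = (fun _ => none : ℕ → Option Bool) i} := by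
    ext r; simp [coinAutomaton]
  rw [hs, h, Set.indicator_of_notMem, zero_mul]
  exact fun h => hq (Set.mem_singleton_iff.1 h).symm

theorem coinAutomaton_visit_succ (w : ℕ → α) (q : Option Bool) (n : ℕ) :
    ((coinAutomaton a).startAt q).runMeasure w {r | r (n + 1) ∈ (coinAutomaton a).final} =
      ∑' q', (coinAutomaton a).trans q (w 0) q' *
        ((coinAutomaton a).startAt q').runMeasure (fun n => w (n + 1))
          {r | r n ∈ (coinAutomaton a).final} :=
  (coinAutomaton a).runMeasure_startAt_apply q w (measurableSet_eval _ (n + 1))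

/-- The final state is not entered by a letter `a`. -/
theorem coinAutomaton_visit_of_eq {w : ℕ → α} {n : ℕ} (h : w n = a) (q : Option Bool) :
    ((coinAutomaton a).startAt q).runMeasure w {r | r (n + 1) ∈ (coinAutomaton a).final} = 0 := by
  have key : ∀ q, ((coinAutomaton a).startAt q).runMeasure (fun i => w (i + n))
      {r | r 1 ∈ (coinAutomaton a).final} = 0 := by
    intro q
    rw [coinAutomaton_visit_succ]
    by_cases hq : q = some false
    · rw [hq, coinAutomaton_tails (by simpa using h), coinAutomaton_visit_zero _ (by simp)]
    · rw [coinAutomaton_heads (by simpa using h) hq, coinAutomaton_visit_zero _ (by simp),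
        coinAutomaton_visit_zero _ (by simp)]
      simp
  have := (coinAutomaton a).runMeasure_shift_le
    (measurableSet_eval (coinAutomaton a).final 1) n w (fun q => (key q).le) q
  rw [add_comm n 1]
  exact nonpos_iff_eq_zero.1 this

/-- The final state is entered at the end of a block of length `k + 1` with probability at most
`2⁻ᵏ`. -/
theorem coinAutomaton_visit_block {k : ℕ} {w : ℕ → α} (hwa : ∀ j < k, w j = a) (hwk : w k ≠ a) :
    ((coinAutomaton a).startAt (some false)).runMeasure w
        {r | r (k + 1) ∈ (coinAutomaton a).final} = 0 ∧
      ∀ q, ((coinAutomaton a).startAt q).runMeasure w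
        {r | r (k + 1) ∈ (coinAutomaton a).final} ≤ 2⁻¹ ^ k := by
  induction k generalizing w with
  | zero =>
    refine ⟨?_, fun q => by simpa using prob_le_one⟩
    rw [coinAutomaton_visit_succ, coinAutomaton_end_tails hwk, coinAutomaton_visit_zero _ (by simp)]
  | succ k ih =>
    obtain ⟨h1, h2⟩ := ih (w := fun n => w (n + 1)) (fun j hj => hwa (j + 1) (by omega)) hwk
    have h3 : ((coinAutomaton a).startAt (some false)).runMeasure w
        {r | r (k + 1 + 1) ∈ (coinAutomaton a).final} = 0 := by
      rw [coinAutomaton_visit_succ, coinAutomaton_tails (hwa 0 k.succ_pos), h1]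
    refine ⟨h3, fun q => ?_⟩
    by_cases hq : q = some false
    · rw [hq, h3]; exact zero_le
    · rw [coinAutomaton_visit_succ, coinAutomaton_heads (hwa 0 k.succ_pos) hq, h1, mul_zero,
        add_zero, pow_succ']
      exact mul_le_mul_right (h2 _) _

end Visit

/-- A word whose blocks become longer and longer is not accepted almost surely. -/
theorem blockWord_notMem_almostSureLanguage {b : α} (hab : a ≠ b) {t k : ℕ → ℕ}
    (hk : ∀ i, t (i + 1) = t i + (k i + 1)) (hik : ∀ i, i ≤ k i) :
    blockWord a b t ∉ (coinAutomaton a).almostSureLanguage := by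
  let _ : MeasurableSpace (Option Bool) := ⊤
  have ht : StrictMono t := strictMono_nat_of_lt_succ fun i => by rw [hk]; omega
  set w := blockWord a b t with hw
  set B := coinAutomaton a with hB
  have hstart : B.startAt (some true) = B := rfl
  have hzero : B.runMeasure w {r | ∃ᶠ n in atTop, r n ∈ B.final} = 0 := by
    -- Borel–Cantelli: final states occur only at block ends, and at the end of block `i` with
    -- probability at most `2⁻¹ ^ k i ≤ 2⁻¹ ^ i`.
    refine measure_setOfPred_frequently_eq_zero (p := fun n (r : ℕ → Option Bool) => r n ∈ B.final) ?_
    have hinj : Function.Injective fun i => t (i + 1) := fun i j h => by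
      have := ht.injective h
      omega
    rw [← hinj.tsum_eq]
    · refine ne_top_of_le_ne_top (b := ∑' i, (2⁻¹ : ℝ≥0∞) ^ i) (by simp) ?_
      refine ENNReal.tsum_le_tsum fun i => ?_
      have key := (coinAutomaton_visit_block (a := a) (k := k i) (w := fun n => w (n + t i))
        (fun j hj => blockWord_of_lt ht (Nat.le_add_left _ _) (by rw [hk]; omega))
        (by rw [hw, blockWord_last (i := i) (by rw [hk]; omega)]; exact hab.symm)).2
      have := B.runMeasure_shift_le (measurableSet_eval B.final (k i + 1)) (t i) w key (some true)
      rw [hstart] at this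
      refine (le_of_eq ?_).trans (this.trans (pow_le_pow_right_of_le_one' (by simp) (hik i)))
      rw [hk, add_comm]
      rfl
    · intro n hn
      rw [Function.mem_support] at hn
      rcases n with - | n
      · exact absurd (coinAutomaton_visit_zero w (by simp)) hn
      · by_contra hcon
        refine hn (coinAutomaton_visit_of_eq (w := w) (if_neg ?_) (some true))
        rintro ⟨i, hi⟩
        exact hcon ⟨i, hi.symm⟩
  rw [B.mem_almostSureLanguage_iff, prob_compl_eq_zero_iff (measurableSet_frequently _), hzero]
  exact zero_ne_one

/-- The almost-sure language of the coin automaton is not regular. -/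
theorem coinAutomaton_almostSureLanguage_notMem_Regular [Nontrivial α] (a : α) :
    (coinAutomaton a).almostSureLanguage ∉ Regular α := by
  intro hreg
  obtain ⟨b, hab⟩ := exists_ne a
  obtain ⟨M, _, _, φ, hφ⟩ := exists_recognizes_of_mem_Regular hreg
  -- Infinitely many block lengths share one value. Enumerated increasingly they give a growing
  -- block word that the monoid cannot tell from the word with constant length `k 0`.
  obtain ⟨m, hm⟩ := Finite.exists_infinite_fiber fun k : ℕ => value φ (List.replicate k a ++ [b])
  obtain ⟨k, hk, hkm⟩ := extraction_of_frequently_atTop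
    (Nat.frequently_atTop_iff_infinite.2 (Set.infinite_coe_iff.1 hm))
  have hkm' : ∀ i, value φ (List.replicate (k i) a ++ [b]) = m := hkm
  let t : ℕ → ℕ := fun i => ∑ j ∈ Finset.range i, (k j + 1)
  have ht : ∀ i, t (i + 1) = t i + (k i + 1) := fun i => Finset.sum_range_succ _ _
  have htm : StrictMono t := strictMono_nat_of_lt_succ fun i => by rw [ht]; omega
  have hsm : StrictMono fun i => i * (k 0 + 1) := strictMono_mul_right_of_pos (k 0).succ_pos
  refine blockWord_notMem_almostSureLanguage hab.symm (t := t) (k := k) ht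
    (fun i => hk.id_le i) ?_
  refine hφ _ _ (fun i => i * (k 0 + 1)) t hsm htm (zero_mul _) rfl (fun i => ?_)
    (blockWord_const_mem_almostSureLanguage hab.symm (k 0))
  rw [factor_blockWord htm (ht i), hkm',
    factor_blockWord hsm (k := k 0) (by ring), hkm']

end CoinAutomaton

end ProbBuchi

/-! ### The hierarchy of the classes -/

theorem mainTheorem6 {α : Type*} [Finite α] [Nontrivial α] :
    (∀ {Q : Type*} [Finite Q] (B : ProbBuchi.PBA α Q) (x : ℝ), x ∈ Set.Icc (0 : ℝ) 1 →
      B.cutpointLanguage x ∈ ProbBuchi.GDelta α) ∧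
    (∀ {Q : Type*} [Finite Q] (B : ProbBuchi.PBA α Q),
      B.almostSureLanguage ∈ ProbBuchi.GDelta α) ∧
    ProbBuchi.Regular α ∩ ProbBuchi.AlmostSure α =
      ProbBuchi.Regular α ∩ ProbBuchi.Deterministic α ∧
    ProbBuchi.Regular α ∩ ProbBuchi.Deterministic α = ProbBuchi.FiniteDeterministic α ∧
    ProbBuchi.Regular α ∩ ProbBuchi.Deterministic α ⊂ ProbBuchi.AlmostSure α ∧
    ProbBuchi.AlmostSure α ⊂ ProbBuchi.GDelta α ∧
    ProbBuchi.GDelta α = ProbBuchi.Deterministic α := by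
  have hGD : ProbBuchi.GDelta α = ProbBuchi.Deterministic α := ProbBuchi.GDelta_eq_Deterministic
  have hFD : ProbBuchi.Regular α ∩ ProbBuchi.Deterministic α = ProbBuchi.FiniteDeterministic α :=
    ProbBuchi.Regular_inter_Deterministic_eq
  have hsub : ProbBuchi.Regular α ∩ ProbBuchi.Deterministic α ⊆ ProbBuchi.AlmostSure α :=
    hFD ▸ ProbBuchi.FiniteDeterministic_subset_AlmostSure
  refine ⟨fun B x _ => B.cutpointLanguage_mem_GDelta x, fun B => ?_, ?_, hFD, ?_, ?_, hGD⟩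
  · rw [B.almostSureLanguage_eq]
    exact B.cutpointLanguage_mem_GDelta 1
  · refine Set.Subset.antisymm (fun L hL => ⟨hL.1, ?_⟩) fun L hL => ⟨hL.1, hsub hL⟩
    exact hGD ▸ ProbBuchi.AlmostSure_subset_GDelta hL.2
  · obtain ⟨a⟩ := (inferInstance : Nonempty α)
    exact ssubset_of_subset_not_subset hsub fun h =>
      ProbBuchi.coinAutomaton_almostSureLanguage_notMem_Regular a
        (h ⟨_, inferInstance, ProbBuchi.coinAutomaton a, rfl⟩).1
  · obtain ⟨L, hL, hL'⟩ := ProbBuchi.exists_mem_GDelta_notMem_AlmostSure (α := α)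
    exact ssubset_of_subset_not_subset ProbBuchi.AlmostSure_subset_GDelta fun h => hL' (h hL)
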